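/- Let $m\ge 2$, let $(|e_j\rangle)_{j=1}^m$ be an orthonormal basis of an $m$-dimensional complex Hilbert space, $|e_0\rangle=\frac1{\sqrt m}\sum_j|e_j\rangle$, and let $0\le r_0\le r_1$ with $r_0+(m-1)r_1=1$. The (obtuse) quantum pyramid is the ensemble $\mathcal E$ of the $m$ equiprobable pure states $|\psi_j\rangle\langle\psi_j|$, where $$|\psi_j\rangle=\sqrt{mr_1}\,|e_j\rangle+(\sqrt{r_0}-\sqrt{r_1})|e_0\rangle=a|e_j\rangle+b\sum_{k\ne j}|e_k\rangle,\qquad b=\frac{\sqrt{r_0}-\sqrt{r_1}}{\sqrt m},\quad a=\sqrt{mr_1}+b.$$ (The endpoint cases are the flat pyramid $r_0=0$ and the orthonormal one $r_0=r_1$.) Put $p=a^2$; then $p\in[\frac{m-1}m,1]$. An observable is a finite family of positive operators $M_k$ with $\sum_kM_k=I$; $I(\mathcal E,M)$ is the Shannon mutual information (binary logarithm, $0\log 0=0$) of the joint distribution $p_{jk}=\frac1m\langle\psi_j|M_k|\psi_j\rangle$; the accessible information is $A(\mathcal E)=\sup_M I(\mathcal E,M)$ over all observables, and $M$ is information-optimal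 if it attains the supremum. Let $$g_m(\tau)=\log\frac{m(m-1+\tau^2)}2-\frac{m-1+\tau}m\log(m-1+\tau)^2-\frac{1-\tau}m\log(1-\tau)^2 ,$$ and let $\tau_o(m)$ be the greatest zero of $g_m$ in $(-\infty,1]$ and $p(m)=\Big[1+(m-1)\big(1-\frac m{1-\tau_o(m)}\big)^{-2}\Big]^{-1}$. For $t\ge1$ let $\mathcal M(t)$ be the observable with the $m+\frac{m(m-1)}2$ components $$M_k=t^{-2}|\tilde e_k\rangle\langle\tilde e_k|,\ \ |\tilde e_k\rangle=|e_k\rangle+\tfrac{t-1}{\sqrt m}|e_0\rangle\ (1\le k\le m);\qquad M_{rs}=\tfrac2m(1-t^{-2})|rs\rangle\langle rs|,\ \ |rs\rangle=\tfrac1{\sqrt2}(|e_r\rangle-|e_s\rangle)\ (1\le r<s\le m).$$ Then: 1. The greatest zero $\tau_o(m)$ exists. For $m\le6$ it is the unique zero of $g_m$ in $[0,1]$; for $m\ge7$ it is negative and $p(m)<\frac{m-1}m$. 2. The following observables are information-optimal: $\mathcal M(1)$ (the square-root measurement) if $m\ge7$; $\mathcal M(1)$ if $m\le6$ and $p\ge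 p(m)$; and $\mathcal M(t)$ with $t=\sqrt{r_1/r_0}\;\tau_o(m)\ge1$ if $m\le6$, $r_0>0$ and $p\le p(m)$. 3. $A(\mathcal E)$ is finite. If $p\in[\max\{\frac{m-1}m,p(m)\},1]$, then $$A(\mathcal E)=\log m+a^2\log a^2+(m-1)b^2\log b^2 .$$ If $m\le6$ and $p\in[\frac{m-1}m,p(m)]$, then $$A(\mathcal E)=\log\frac m2-r_0\big(\tau_o(m)^{-1}-1\big)\log\frac{2(\tau_o(m)-1)^2}{m(m-1+\tau_o(m)^2)}=\log\frac m2-r_0\,m\,\tilde\mu_0(p(m)),$$ where $$\tilde\mu_0(p)=\frac{\sqrt{\frac{p(1-p)}{m-1}}\big(\log p-\log\frac{1-p}{m-1}\big)}{\big((m-1)\sqrt{\frac{1-p}{m-1}}-\sqrt p\big)\big(\sqrt p+\sqrt{\frac{1-p}{m-1}}\big)}$$ (for $m=2$ the last case occurs only for $r_0=0$, where $\tau_o(2)=0$ and the terms multiplied by $r_0$ are read as $0$). -/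

import Mathlib

noncomputable section

namespace QPyramid

/-! ### Ensembles, observables, accessible information -/

/-- A finite ensemble `{π_j, ρ_j}` of quantum states (density operators) on a finite-dimensional
Hilbert space. -/
structure Ensemble (ι : Type*) [Fintype ι] (H : Type*) [NormedAddCommGroup H]
    [InnerProductSpace ℂ H] [FiniteDimensional ℂ H] where
  prob : ι → ℝ
  state : ι → H →L[ℂ] H
  prob_nonneg : ∀ j, 0 ≤ prob j
  prob_sum : ∑ j, prob j = 1
  state_pos : ∀ j, (state j).IsPositive
  state_trace : ∀ j, LinearMap.trace ℂ H (state j : H →ₗ[ℂ] H) = 1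

/-- An observable with outcome set `κ`: positive operators summing to the unit operator. -/
def IsObservable {κ : Type*} [Fintype κ] {H : Type*} [NormedAddCommGroup H]
    [InnerProductSpace ℂ H] (M : κ → H →L[ℂ] H) : Prop :=
  (∀ k, (M k).IsPositive) ∧ ∑ k, M k = ContinuousLinearMap.id ℂ H

section
variable {ι : Type*} [Fintype ι] {κ : Type*} [Fintype κ] {H : Type*} [NormedAddCommGroup H]
  [InnerProductSpace ℂ H] [FiniteDimensional ℂ H]

/-- Joint distribution `p_{jk} = π_j Tr ρ_j M_k` of input `j` and output `k`. -/
def jointProb (E : Ensemble ι H) (M : κ → H →L[ℂ] H) (j : ι) (k : κ) : ℝ :=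
  E.prob j * (LinearMap.trace ℂ H ((E.state j ∘L M k : H →L[ℂ] H) : H →ₗ[ℂ] H)).re

/-- Output distribution `p_k = ∑_j p_{jk}`. -/
def outcomeProb (E : Ensemble ι H) (M : κ → H →L[ℂ] H) (k : κ) : ℝ :=
  ∑ j, jointProb E M j k

/-- Shannon mutual information (binary logarithm) between input and output. A term with
`p_{jk} = 0` is zero. -/
def mutualInfo (E : Ensemble ι H) (M : κ → H →L[ℂ] H) : ℝ :=
  ∑ j, ∑ k, jointProb E M j k *
    Real.logb 2 (jointProb E M j k / (E.prob j * outcomeProb E M k))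

/-- All values of the mutual information over observables with finitely many outcomes. -/
def infoValues (E : Ensemble ι H) : Set ℝ :=
  {I | ∃ (n : ℕ) (M : Fin n → H →L[ℂ] H), IsObservable M ∧ I = mutualInfo E M}

/-- Accessible information of an ensemble. -/
def accessibleInfo (E : Ensemble ι H) : ℝ := sSup (infoValues E)

/-- `M` is an information-optimal observable: it is an observable and no observable gives more
mutual information. -/
def IsInfoOptimal (E : Ensemble ι H) (M : κ → H →L[ℂ] H) : Prop :=
  IsObservable M ∧ ∀ (n : ℕ) (N : Fin n → H →L[ℂ] H), IsObservable N →
    mutualInfo E N ≤ mutualInfo E M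

end

/-! ### Quantum pyramids -/

section
variable {m : ℕ} {H : Type*} [NormedAddCommGroup H] [InnerProductSpace ℂ H]

/-- The axis vector `|e₀⟩ = m^{-1/2} ∑_j |e_j⟩`. -/
def axis (e : OrthonormalBasis (Fin m) ℂ H) : H :=
  ((1 / √(m : ℝ) : ℝ) : ℂ) • ∑ j, e j

/-- The edge vectors `|ψ_j⟩ = √(m r₁) |e_j⟩ + (√r₀ - √r₁) |e₀⟩` of the pyramid. -/
def edge (e : OrthonormalBasis (Fin m) ℂ H) (r0 r1 : ℝ) (j : Fin m) : H :=
  ((√(m * r1) : ℝ) : ℂ) • e j + ((√r0 - √r1 : ℝ) : ℂ) • axis e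

lemma inner_basis_axis (e : OrthonormalBasis (Fin m) ℂ H) (j : Fin m) :
    inner ℂ (e j) (axis e) = ((1 / √(m : ℝ) : ℝ) : ℂ) := by
  unfold axis
  rw [inner_smul_right, inner_sum, Finset.sum_eq_single j]
  · simp
  · intro i _ hi
    rw [e.inner_eq_ite, if_neg (Ne.symm hi)]
  · simp

lemma inner_axis_axis (e : OrthonormalBasis (Fin m) ℂ H) (hm : 2 ≤ m) :
    inner ℂ (axis e) (axis e) = (1 : ℂ) := by
  have h0 : (0 : ℝ) < m := by exact_mod_cast (by omega : 0 < m)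
  conv_lhs => arg 2; unfold axis
  rw [inner_smul_left, sum_inner]
  simp_rw [inner_basis_axis]
  rw [Finset.sum_const, Finset.card_univ, Fintype.card_fin, nsmul_eq_mul, Complex.conj_ofReal]
  norm_cast
  have h1 : √(m : ℝ) * √(m : ℝ) = m := Real.mul_self_sqrt h0.le
  have h2 : √(m : ℝ) ≠ 0 := (Real.sqrt_pos.2 h0).ne'
  field_simp
  nlinarith

lemma inner_edge_self (e : OrthonormalBasis (Fin m) ℂ H) {r0 r1 : ℝ} (hm : 2 ≤ m)
    (h0 : 0 ≤ r0) (h1 : 0 ≤ r1) (hs : r0 + (m - 1) * r1 = 1) (j : Fin m) :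
    inner ℂ (edge e r0 r1 j) (edge e r0 r1 j) = (1 : ℂ) := by
  have hm0 : (0 : ℝ) < m := by exact_mod_cast (by omega : 0 < m)
  have hax : inner ℂ (axis e) (e j) = ((1 / √(m : ℝ) : ℝ) : ℂ) := by
    rw [← inner_conj_symm, inner_basis_axis, Complex.conj_ofReal]
  unfold edge
  simp only [inner_add_left, inner_add_right, inner_smul_left, inner_smul_right,
    Complex.conj_ofReal, inner_basis_axis, hax, inner_axis_axis e hm]
  rw [e.inner_eq_ite, if_pos rfl]
  norm_cast
  have hq : √(m : ℝ) ≠ 0 := (Real.sqrt_pos.2 hm0).ne'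
  have h2 : √(m : ℝ) * √(m : ℝ) = m := Real.mul_self_sqrt hm0.le
  have h3 : √r0 * √r0 = r0 := Real.mul_self_sqrt h0
  have h4 : √r1 * √r1 = r1 := Real.mul_self_sqrt h1
  rw [Real.sqrt_mul hm0.le]
  field_simp
  linear_combination (√r1 * √r1) * h2 + h3 + ((m : ℝ) - 1) * h4 + hs

variable [FiniteDimensional ℂ H]

/-- The ensemble of the `m` equiprobable pure states `|ψ_j⟩⟨ψ_j|` of the pyramid. -/
def pyramidEnsemble (e : OrthonormalBasis (Fin m) ℂ H) (r0 r1 : ℝ) (hm : 2 ≤ m)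
    (h0 : 0 ≤ r0) (h1 : 0 ≤ r1) (hs : r0 + (m - 1) * r1 = 1) : Ensemble (Fin m) H where
  prob _ := 1 / (m : ℝ)
  state j := InnerProductSpace.rankOne ℂ (edge e r0 r1 j) (edge e r0 r1 j)
  prob_nonneg _ := by positivity
  prob_sum := by
    have : (m : ℝ) ≠ 0 := by exact_mod_cast (by omega : m ≠ 0)
    simp [this]
  state_pos _ := InnerProductSpace.isPositive_rankOne_self _
  state_trace j := by
    rw [InnerProductSpace.trace_rankOne]
    exact inner_edge_self e hm h0 h1 hs j


/-- `|ẽ_k⟩ = |e_k⟩ + (t - 1) m^{-1/2} |e₀⟩`. -/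
def etilde (e : OrthonormalBasis (Fin m) ℂ H) (t : ℝ) (k : Fin m) : H :=
  e k + (((t - 1) / √(m : ℝ) : ℝ) : ℂ) • axis e

/-- `|rs⟩ = 2^{-1/2} (|e_r⟩ - |e_s⟩)`. -/
def diffVec (e : OrthonormalBasis (Fin m) ℂ H) (r s : Fin m) : H :=
  ((1 / √2 : ℝ) : ℂ) • (e r - e s)

/-- The `m + m(m-1)/2` component family `M_k = t^{-2} |ẽ_k⟩⟨ẽ_k|`, `k = 1, …, m`, and
`M_{rs} = (2/m) (1 - t^{-2}) |rs⟩⟨rs|`, `r < s`. For `t = 1` it is the square-root measurement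
`|e_k⟩⟨e_k|` (supplemented by zero components). -/
def pyramidObservable (e : OrthonormalBasis (Fin m) ℂ H) (t : ℝ) :
    Fin m ⊕ {q : Fin m × Fin m // q.1 < q.2} → H →L[ℂ] H
  | Sum.inl k => (((t ^ 2)⁻¹ : ℝ) : ℂ) • InnerProductSpace.rankOne ℂ (etilde e t k) (etilde e t k)
  | Sum.inr q => ((2 / (m : ℝ) * (1 - (t ^ 2)⁻¹) : ℝ) : ℂ) •
      InnerProductSpace.rankOne ℂ (diffVec e q.1.1 q.1.2) (diffVec e q.1.1 q.1.2)

end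

/-! ### The numerical parameters -/

/-- The coefficient `b = (√r₀ - √r₁)/√m` in `|ψ_j⟩ = a |e_j⟩ + b ∑_{k ≠ j} |e_k⟩`. -/
def coefB (m : ℕ) (r0 r1 : ℝ) : ℝ := (√r0 - √r1) / √(m : ℝ)

/-- The coefficient `a = √(m r₁) + (√r₀ - √r₁)/√m` in `|ψ_j⟩ = a |e_j⟩ + b ∑_{k ≠ j} |e_k⟩`. -/
def coefA (m : ℕ) (r0 r1 : ℝ) : ℝ := √(m * r1) + (√r0 - √r1) / √(m : ℝ)

/-- The value `log m + a² log a² + (m-1) b² log b²` (with `0 log 0 = 0`). -/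
def srmInfo (m : ℕ) (r0 r1 : ℝ) : ℝ :=
  Real.logb 2 m + coefA m r0 r1 ^ 2 * Real.logb 2 (coefA m r0 r1 ^ 2)
    + (m - 1) * coefB m r0 r1 ^ 2 * Real.logb 2 (coefB m r0 r1 ^ 2)

/-- The function whose zero determines the optimal parameter of nearly flat obtuse pyramids
(with `0 log 0 = 0`). -/
def gObt (m : ℕ) (τ : ℝ) : ℝ :=
  Real.logb 2 (m * (m - 1 + τ ^ 2) / 2)
    - (m - 1 + τ) / m * Real.logb 2 ((m - 1 + τ) ^ 2)
    - (1 - τ) / m * Real.logb 2 ((1 - τ) ^ 2)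

/-- `τ_o(m)`: the greatest zero of `gObt m` in `(-∞, 1]`. It is the only zero in `[0, 1]` for
`m ≤ 6`, and negative for `m ≥ 7`. -/
def tauObt (m : ℕ) : ℝ := sSup {τ : ℝ | τ ≤ 1 ∧ gObt m τ = 0}

/-- `p(m) = [1 + (m-1) (1 - m/(1 - τ_o(m)))^{-2}]^{-1}`. -/
def pObt (m : ℕ) : ℝ := (1 + (m - 1) * ((1 - m / (1 - tauObt m)) ^ 2)⁻¹)⁻¹

/-- The coefficient `μ̃₀(p)`. -/
def muTilde0 (m : ℕ) (p : ℝ) : ℝ :=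
  √(p * (1 - p) / (m - 1)) * (Real.logb 2 p - Real.logb 2 ((1 - p) / (m - 1))) /
    (((m - 1) * √((1 - p) / (m - 1)) - √p) * (√p + √((1 - p) / (m - 1))))

end QPyramid

end

-- The proof is a duality argument. For a vector v, put y_j = ⟨ψ_j|v⟩. Up to the constant log m and
-- a normalization, the information of an observable is the sum of `negEntropy` of the |y_j|² over
-- its rank-one pieces; `negEntropy` is convex and homogeneous, so splitting into such pieces loses
-- no information. Suppose that `negEntropy` of the |y_j|² is at most c ∑|y_j|² + μ |∑ y_j|² for all
-- y. Since ∑ M_k = I and ∑ ψ_j = m √r0 e_0, the right-hand sides add up to a number independent of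
-- the observable. This bounds every information value, with equality when the majorant touches at
-- each component.
--
-- The coefficients `constCoef` and `sumCoef` make the majorant touch at (1, -β, …, -β). It holds as
-- soon as c ≥ -log 2, the level forced by (1, -1, 0, …, 0); this is `negEntropy_le`. There a
-- maximizer on the unit sphere is, up to a phase and a rescaling, a real vector whose entries all
-- solve z log |z| = v with one v > 0. If c exceeded the claimed value, the squares would add up to
-- less than 2. By `two_lt_sq_add_sq_add_sq` the vector would then be proportional to (1, -t, …,
-- -t), and monotonicity of `sumCoef` gives t = β.
--
-- For the pyramid, ẽ_k has amplitudes proportional to (1, -β, …, -β) with β = `edgeRatio m τ` when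
-- t √r0 = τ √r1, and c ≥ -log 2 means `gObt m τ ≤ 0` (`constCoef_edgeRatio`). If τ = √(r0/r1)
-- satisfies this, t = 1 is optimal. Otherwise τ is raised to τ_o, where c = -log 2: the majorant
-- then touches at the |rs⟩ as well, and 𝓜(t) is optimal. The sign of `gObt m 0` separates m ≤ 6
-- from m ≥ 7. For r0 = 0 the limit t → ∞ is realized by `flatObservable`.

noncomputable section

namespace QPyramid

open Real

/-! ### Elementary logarithmic inequalities -/

lemma two_mul_log_le_sub_inv {x : ℝ} (hx : 1 ≤ x) : 2 * log x ≤ x - x⁻¹ := by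
  have h0 : 0 < x := by linarith
  have h := Real.self_le_sinh_iff.2 (Real.log_nonneg hx)
  rw [Real.sinh_log h0] at h
  linarith

/-- Since log x > 1 - 1/x, the derivative of f exceeds (1 - x)²/x, and f(1) = 0. -/
lemma one_sub_sq_lt_neg_log_mul {t : ℝ} (h0 : 0 < t) (h1 : t < 1) :
    1 - t ^ 2 < -log t * (1 + t ^ 2) := by
  let f : ℝ → ℝ := fun t => log t * (1 + t ^ 2) + 1 - t ^ 2
  have hd : ∀ x : ℝ, 0 < x →
      HasDerivAt f (x⁻¹ * (1 + x ^ 2) + log x * (2 * x) - 2 * x) x := by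
    intro x hx
    have := (((Real.hasDerivAt_log hx.ne').mul (((hasDerivAt_id x).pow 2).const_add 1)).add_const
      1).sub ((hasDerivAt_id x).pow 2)
    refine HasDerivAt.congr_deriv this ?_
    simp only [id, Pi.pow_apply]
    norm_num
  have hmono : StrictMonoOn f (Set.Ioc 0 1) := by
    refine strictMonoOn_of_deriv_pos (convex_Ioc 0 1)
      (fun x hx => (hd x hx.1).continuousAt.continuousWithinAt) ?_
    intro x hx
    rw [interior_Ioc] at hx
    have hx0 := hx.1
    rw [(hd x hx.1).deriv]
    have h2 : log x⁻¹ < x⁻¹ - 1 :=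
      Real.log_lt_sub_one_of_pos (inv_pos.2 hx.1) (by
        intro h; have := inv_eq_one.1 h; linarith [hx.2])
    rw [Real.log_inv] at h2
    have h3 : x * x⁻¹ = 1 := mul_inv_cancel₀ hx.1.ne'
    have h4 : 0 < x⁻¹ := inv_pos.2 hx.1
    have h5 : 0 < (log x - (1 - x⁻¹)) * (2 * x) := by
      apply mul_pos <;> linarith
    have h6 : 0 < (1 - x) ^ 2 * x⁻¹ := by
      have := hx.2
      have : 0 < 1 - x := by linarith
      positivity
    have h7 : 0 < x * x := by positivity
    nlinarith
  have := hmono ⟨h0, h1.le⟩ ⟨one_pos, le_rfl⟩ h1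
  simp only [f, Real.log_one] at this
  linarith

/-- This single inequality decides the sign of the derivatives of both `constCoef n` and `sumCoef
n`. Multiplying through by 1 + t² reduces it to the case n = 1. -/
lemma one_add_mul_lt_neg_log_mul {n t : ℝ} (hn : 1 ≤ n) (h0 : 0 < t) (h1 : n * t < 1) :
    (1 + t) * (1 - n * t) < -log t * (1 + n * t ^ 2) := by
  have ht1 : t < 1 := by nlinarith
  have h := one_sub_sq_lt_neg_log_mul h0 ht1
  have hpos : 0 < 1 + t ^ 2 := by positivity
  have hpos' : 0 < 1 + n * t ^ 2 := by positivity
  have h2 : (1 + t) * (1 - n * t) * (1 + t ^ 2) ≤ (1 - t ^ 2) * (1 + n * t ^ 2) := by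
    have : 0 ≤ (1 + t) * ((n - 1) * (t + t ^ 2)) := by
      have : 0 ≤ n - 1 := by linarith
      positivity
    nlinarith
  have h3 : (1 - t ^ 2) * (1 + n * t ^ 2) < -log t * (1 + t ^ 2) * (1 + n * t ^ 2) :=
    mul_lt_mul_of_pos_right h hpos'
  nlinarith

/-! ### The two coefficients of the quadratic majorant -/

/-- The constant coefficient of the majorant touching at `(1, -β, …, -β)`. -/
def constCoef (n β : ℝ) : ℝ := 2 * (β * log β) / (1 + β) - log (1 + n * β ^ 2)

/-- The coefficient of the squared modulus of the sum in the majorant touching at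
`(1, -β, …, -β)`. -/
def sumCoef (n β : ℝ) : ℝ := -(2 * (β * log β)) / ((1 + β) * (1 - n * β))

lemma continuousAt_constCoef {n β : ℝ} (hn : 0 ≤ n) (hβ : 0 ≤ β) :
    ContinuousAt (constCoef n) β := by
  unfold constCoef
  have h1 : (1 + β) ≠ 0 := by positivity
  have h2 : 1 + n * β ^ 2 ≠ 0 := by positivity
  have h3 : Continuous fun x : ℝ => x * log x := Real.continuous_mul_log
  exact ((h3.continuousAt.const_mul 2).div (by fun_prop) h1).sub
    (ContinuousAt.log (by fun_prop) h2)

lemma constCoef_strictAntiOn {n : ℝ} (hn : 1 ≤ n) :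
    StrictAntiOn (constCoef n) (Set.Icc 0 (1 / n)) := by
  have hn0 : 0 < n := by linarith
  refine strictAntiOn_of_deriv_neg (convex_Icc _ _)
    (fun x hx => (continuousAt_constCoef hn0.le hx.1).continuousWithinAt) ?_
  intro t ht
  rw [interior_Icc] at ht
  obtain ⟨h0, h1⟩ := ht
  have h1' : n * t < 1 := by rwa [lt_div_iff₀ hn0, mul_comm] at h1
  have hk := one_add_mul_lt_neg_log_mul hn h0 h1'
  have hp1 : 0 < 1 + t := by linarith
  have hp2 : 0 < 1 + n * t ^ 2 := by positivity
  have hd : HasDerivAt (constCoef n)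
      ((2 * (log t + 1) * (1 + t) - 2 * (t * log t) * 1) / (1 + t) ^ 2
        - (n * (2 * t)) / (1 + n * t ^ 2)) t := by
    have ha := ((Real.hasDerivAt_mul_log h0.ne').const_mul 2).div
      ((hasDerivAt_id t).const_add 1) hp1.ne'
    have hb := ((((hasDerivAt_id t).pow 2).const_mul n).const_add 1).log hp2.ne'
    refine HasDerivAt.congr_deriv (ha.sub hb) ?_
    simp only [id, Pi.pow_apply]
    norm_num
  rw [hd.deriv, sub_neg, div_lt_div_iff₀ (by positivity) hp2]
  nlinarith

lemma sumCoef_strictMonoOn {n : ℝ} (hn : 1 ≤ n) :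
    StrictMonoOn (sumCoef n) (Set.Ioo 0 (1 / n)) := by
  have hn0 : 0 < n := by linarith
  have key : ∀ t ∈ Set.Ioo 0 (1 / n), ∃ d, 0 < d ∧ HasDerivAt (sumCoef n) d t := by
    intro t ht
    obtain ⟨h0, h1⟩ := ht
    have h1' : n * t < 1 := by rwa [lt_div_iff₀ hn0, mul_comm] at h1
    have hk := one_add_mul_lt_neg_log_mul hn h0 h1'
    have hp1 : 0 < 1 + t := by linarith
    have hp2 : 0 < 1 - n * t := by linarith
    have hB : (1 + t) * (1 - n * t) ≠ 0 := by positivity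
    have ha := (((Real.hasDerivAt_mul_log h0.ne').const_mul 2).neg).div
      (((hasDerivAt_id t).const_add 1).mul (((hasDerivAt_id t).const_mul n).const_sub 1)) hB
    refine ⟨_, ?_, ha⟩
    apply div_pos _ (by simp only [Pi.mul_apply, id]; positivity)
    simp only [Pi.mul_apply, Pi.neg_apply, id]
    nlinarith
  refine strictMonoOn_of_deriv_pos (convex_Ioo _ _) (fun x hx => ?_) ?_
  · obtain ⟨d, _, hd⟩ := key x hx
    exact hd.continuousAt.continuousWithinAt
  · intro x hx
    rw [interior_Ioo] at hx
    obtain ⟨d, hp, hd⟩ := key x hx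
    rwa [hd.deriv]

lemma sumCoef_pos {n β : ℝ} (hn : 1 ≤ n) (h0 : 0 < β) (h1 : n * β < 1) : 0 < sumCoef n β := by
  have hb : β < 1 := by nlinarith
  have := Real.log_neg h0 hb
  have h2 : 0 < 1 - n * β := by linarith
  unfold sumCoef
  apply div_pos _ (by positivity)
  nlinarith

/-! ### Three solutions of `|z log z| = v` -/

/-- The left side is (exp l - l)² - l² - 1, with expansion l³/3 + l⁴/3 + 11 l⁵/60 + …. The excess of
29/100 over 11/60 absorbs all later terms on [0, 1], while 1/3 + 1/3 + 29/100 stays below 1, as the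
strict comparison with exp(-y)² requires. -/
lemma exp_sub_sq_le {l : ℝ} (h0 : 0 ≤ l) (h1 : l ≤ 1) :
    exp l ^ 2 - 2 * l * exp l - 1 ≤ l ^ 3 * (1 / 3 + l / 3 + 29 / 100 * l ^ 2) := by
  have hT := Real.exp_bound' h0 h1 (n := 6) (by norm_num)
  simp only [Finset.sum_range_succ, Finset.sum_range_zero, Nat.factorial] at hT
  norm_num at hT
  have hl := Real.add_one_le_exp l
  set T := 1 + l + l ^ 2 / 2 + l ^ 3 / 6 + l ^ 4 / 24 + l ^ 5 / 120 + l ^ 6 * 7 / 4320 with hTd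
  have hT' : exp l ≤ T := by rw [hTd]; linarith
  have hsq : (exp l - l) ^ 2 ≤ (T - l) ^ 2 := by
    apply pow_le_pow_left₀ <;> linarith
  have hpoly : (T - l) ^ 2 - l ^ 2 - 1 ≤ l ^ 3 * (1 / 3 + l / 3 + 29 / 100 * l ^ 2) := by
    have e : l ^ 3 * (1 / 3 + l / 3 + 29 / 100 * l ^ 2) - ((T - l) ^ 2 - l ^ 2 - 1) =
        l ^ 5 * ((29 / 100 - 11 / 60) - 157 / 2160 * l - 1 / 45 * l ^ 2 - 53 / 8640 * l ^ 3
          - 1 / 810 * l ^ 4 - 53 / 259200 * l ^ 5 - 7 / 259200 * l ^ 6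
          - 49 / 18662400 * l ^ 7) := by
      rw [hTd]; ring
    have hb : ∀ k : ℕ, l ^ k ≤ 1 := fun k => pow_le_one₀ h0 h1
    have : 0 ≤ l ^ 5 * ((29 / 100 - 11 / 60) - 157 / 2160 * l - 1 / 45 * l ^ 2 - 53 / 8640 * l ^ 3
          - 1 / 810 * l ^ 4 - 53 / 259200 * l ^ 5 - 7 / 259200 * l ^ 6
          - 49 / 18662400 * l ^ 7) := by
      apply mul_nonneg (by positivity)
      linarith [hb 2, hb 3, hb 4, hb 5, hb 6, hb 7]
    linarith
  nlinarith

lemma mul_cubic_le_exp_sub_one {y : ℝ} (hy : 0 ≤ y) :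
    y * (1 + y / 2 + y ^ 2 / 6 + y ^ 3 / 24) ≤ exp y - 1 := by
  have h := Real.sum_le_exp_of_nonneg hy 5
  simp only [Finset.sum_range_succ, Finset.sum_range_zero, Nat.factorial] at h
  norm_num at h
  linarith

/-- With l = -log β and y = log (β/α), the constraint expresses α log α = β log β. It gives l exp y
= l + y and l ≤ 1/D, so after multiplication by exp(2y) a rational inequality in y remains. -/
lemma exp_sub_sq_lt_exp_neg {l y : ℝ} (hl : 0 < l) (hy : 0 < y) (h : l * (exp y - 1) = y) :
    exp l ^ 2 - 2 * l * exp l - 1 < exp (-y) ^ 2 := by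
  set D := 1 + y / 2 + y ^ 2 / 6 + y ^ 3 / 24 with hD
  have hDpos : 1 ≤ D := by rw [hD]; have : 0 ≤ y / 2 + y ^ 2 / 6 + y ^ 3 / 24 := by positivity
                           linarith
  have hyD : l * (y * D) ≤ y := by
    calc l * (y * D) ≤ l * (exp y - 1) :=
          mul_le_mul_of_nonneg_left (mul_cubic_le_exp_sub_one hy.le) hl.le
      _ = y := h
  have hlD : l * D ≤ 1 := by
    have : y * (l * D) ≤ y * 1 := by linarith
    exact le_of_mul_le_mul_left this hy
  have hlD' : l ≤ 1 / D := by rwa [le_div_iff₀ (by linarith)]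
  have hl1 : l ≤ 1 := by nlinarith
  refine (exp_sub_sq_le hl.le hl1).trans_lt ?_
  have hpoly : (1 / D + y) ^ 2 * (1 / D) * (1 / 3 + (1 / D) / 3 + 29 / 100 * (1 / D) ^ 2) < 1 := by
    have hD0 : D ≠ 0 := by linarith
    have e : (1 / D + y) ^ 2 * (1 / D) * (1 / 3 + (1 / D) / 3 + 29 / 100 * (1 / D) ^ 2) =
        (1 + y * D) ^ 2 * (D ^ 2 / 3 + D / 3 + 29 / 100) / D ^ 5 := by
      field_simp
    rw [e, div_lt_one (by positivity), ← sub_pos, hD]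
    -- Expanded in powers of y, the difference has only positive coefficients.
    ring_nf
    positivity
  have hq : l * exp y = l + y := by linarith
  have hle : (l + y) ^ 2 * l * (1 / 3 + l / 3 + 29 / 100 * l ^ 2) < 1 := by
    refine lt_of_le_of_lt ?_ hpoly
    gcongr
  rw [Real.exp_neg, inv_pow, ← one_div, lt_div_iff₀ (by positivity)]
  calc _ = (l * exp y) ^ 2 * l * (1 / 3 + l / 3 + 29 / 100 * l ^ 2) := by ring
    _ < 1 := by rw [hq]; exact hle

/-- If `x > 1 > β > α > 0` have the same value of `|z log z|`, their squares add up to more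
than `2`. -/
lemma two_lt_sq_add_sq_add_sq {x α β : ℝ} (hx : 1 < x) (hα : 0 < α) (hαβ : α < β) (hβ : β < 1)
    (hxβ : x * log x = -(β * log β)) (h : α * log α = β * log β) :
    2 < x ^ 2 + α ^ 2 + β ^ 2 := by
  have hβ0 : 0 < β := hα.trans hαβ
  -- As x log x = -β log β, this removes x; dividing what is left by β² turns it into
  -- `exp_sub_sq_lt_exp_neg`.
  have hx2 : 1 + 2 * (x * log x) ≤ x ^ 2 := by
    have h1 := two_mul_log_le_sub_inv hx.le
    have h2 : x * (2 * log x) ≤ x * (x - x⁻¹) := mul_le_mul_of_nonneg_left h1 (by linarith)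
    have h3 : x * x⁻¹ = 1 := mul_inv_cancel₀ (by linarith)
    nlinarith
  set l := -log β with hl
  set y := log β - log α with hy
  have hl0 : 0 < l := by rw [hl]; linarith [Real.log_neg hβ0 hβ]
  have hy0 : 0 < y := by rw [hy]; linarith [Real.log_lt_log hα hαβ]
  have eβ : exp (-l) = β := by rw [hl, neg_neg, Real.exp_log hβ0]
  have ey : exp y = β / α := by rw [hy, Real.exp_sub, Real.exp_log hβ0, Real.exp_log hα]
  have hly : l * (exp y - 1) = y := by
    rw [ey, hl, hy]
    field_simp
    linarith
  have hk := exp_sub_sq_lt_exp_neg hl0 hy0 hly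
  have eβ' : exp l * β = 1 := by rw [← eβ, ← Real.exp_add]; simp
  have ey' : exp (-y) * β = α := by
    rw [Real.exp_neg, ey]; field_simp
  have h4 : (exp l ^ 2 - 2 * l * exp l - 1) * β ^ 2 < exp (-y) ^ 2 * β ^ 2 :=
    mul_lt_mul_of_pos_right hk (by positivity)
  have h5 : exp (-y) ^ 2 * β ^ 2 = α ^ 2 := by rw [← mul_pow, ey']
  have h6 : (exp l ^ 2 - 2 * l * exp l - 1) * β ^ 2 = 1 - 2 * l * β - β ^ 2 := by
    have : (exp l ^ 2 - 2 * l * exp l - 1) * β ^ 2 =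
      (exp l * β) ^ 2 - 2 * l * (exp l * β) * β - β ^ 2 := by ring
    rw [this, eβ']; ring
  rw [h5, h6] at h4
  have h7 : x * log x = l * β := by rw [hxβ, hl]; ring
  nlinarith

end QPyramid

end

noncomputable section

namespace QPyramid

open Real

/-! ### The entropic inequality -/

lemma two_lt_sq_add_sq_of_one_lt {x y : ℝ} (hx : 1 < x) (hy : 1 < y) : 2 < x ^ 2 + y ^ 2 := by
  nlinarith

/-- `Real.log` is even, so the equation covers both signs: positive roots exceed 1, negative ones
lie in (-1, 0). Two positive roots, or a positive root with two distinct negative ones, would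
already have squares adding up to more than 2. -/
lemma eq_const_of_mul_log_eq {ι : Type*} [Fintype ι] {z : ι → ℝ} {v : ℝ} (hv : 0 < v)
    (hz : ∀ j, z j * log (z j) = v) (hsum : 0 < ∑ j, z j) (hsq : ∑ j, z j ^ 2 < 2) :
    ∃ i, 0 < z i ∧ ∃ α, 0 < α ∧ ∀ j, j ≠ i → z j = -α := by
  classical
  have hpair : ∀ i j, i ≠ j → z i ^ 2 + z j ^ 2 < 2 := by
    intro i j hij
    refine lt_of_le_of_lt ?_ hsq
    rw [← Finset.sum_pair (f := fun j => z j ^ 2) hij]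
    exact Finset.sum_le_sum_of_subset_of_nonneg (Finset.subset_univ _) fun _ _ _ => sq_nonneg _
  have htriple : ∀ i j k, i ≠ j → i ≠ k → j ≠ k → z i ^ 2 + z j ^ 2 + z k ^ 2 < 2 := by
    intro i j k hij hik hjk
    refine lt_of_le_of_lt ?_ hsq
    have : ∑ a ∈ ({i, j, k} : Finset ι), z a ^ 2 = z i ^ 2 + z j ^ 2 + z k ^ 2 := by
      rw [Finset.sum_insert (by simp [hij, hik]), Finset.sum_pair hjk]; ring
    rw [← this]
    exact Finset.sum_le_sum_of_subset_of_nonneg (Finset.subset_univ _) fun _ _ _ => sq_nonneg _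
  have hpos : ∀ j, 0 < z j → 1 < z j := by
    intro j hj
    by_contra hle
    push Not at hle
    have := Real.log_nonpos hj.le hle
    have := hz j
    nlinarith
  have hne : ∀ j, z j ≠ 0 := by
    intro j h0
    have := hz j
    rw [h0] at this
    simp at this
    exact hv.ne this
  have hneg : ∀ j, z j < 0 → 0 < -z j ∧ -z j < 1 ∧ -z j * log (-z j) = -v := by
    intro j hj
    have h1 := hz j
    have hl : log (z j) < 0 := by
      by_contra hle
      push Not at hle
      nlinarith
    refine ⟨by linarith, ?_, by rw [Real.log_neg_eq_log]; linarith⟩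
    rw [← Real.log_neg_eq_log] at hl
    by_contra hle
    push Not at hle
    linarith [Real.log_nonneg hle]
  obtain ⟨i, -, hi⟩ : ∃ i ∈ Finset.univ, 0 < z i := Finset.exists_lt_of_sum_lt (by simpa using hsum)
  have hi1 := hpos i hi
  have hothers : ∀ j, j ≠ i → z j < 0 := by
    intro j hj
    rcases lt_or_gt_of_ne (hne j) with h | h
    · exact h
    · have := two_lt_sq_add_sq_of_one_lt hi1 (hpos j h)
      linarith [hpair i j (Ne.symm hj)]
  have hsame : ∀ j k, j ≠ i → k ≠ i → ¬ (-z j < -z k) := by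
    intro j k hj hk hlt
    obtain ⟨a1, a2, a3⟩ := hneg j (hothers j hj)
    obtain ⟨b1, b2, b3⟩ := hneg k (hothers k hk)
    have := two_lt_sq_add_sq_add_sq hi1 a1 hlt b2 (by rw [hz i, b3, neg_neg]) (by rw [a3, b3])
    have hjk : j ≠ k := by rintro rfl; exact lt_irrefl _ hlt
    have := htriple i j k (Ne.symm hj) (Ne.symm hk) hjk
    nlinarith
  refine ⟨i, hi, ?_⟩
  by_cases hex : ∃ k, k ≠ i
  · obtain ⟨k, hk⟩ := hex
    refine ⟨-z k, (hneg k (hothers k hk)).1, fun j hj => ?_⟩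
    have h1 := hsame j k hj hk
    have h2 := hsame k j hk hj
    push Not at h1 h2
    linarith
  · push Not at hex
    -- The index set is a singleton here, so any positive value serves.
    exact ⟨1, one_pos, fun j hj => absurd (hex j) hj⟩

lemma hasDerivAt_sq_mul_log_sq : HasDerivAt (fun t : ℝ => t ^ 2 * log (t ^ 2)) 0 0 := by
  rw [hasDerivAt_iff_tendsto_slope_zero]
  have h : Filter.Tendsto (fun t : ℝ => 2 * (t * log t)) (nhdsWithin 0 {0}ᶜ) (nhds 0) := by
    have : Continuous fun t : ℝ => 2 * (t * log t) := Real.continuous_mul_log.const_mul 2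
    simpa using (this.tendsto 0).mono_left nhdsWithin_le_nhds
  refine h.congr' ?_
  filter_upwards [self_mem_nhdsWithin] with t ht
  have ht : t ≠ 0 := ht
  simp only [zero_add, smul_eq_mul, Real.log_pow]
  field_simp
  push_cast
  ring

lemma hasDerivAt_norm_add_smul_sq (z d : ℂ) :
    HasDerivAt (fun t : ℝ => ‖z + t * d‖ ^ 2) (2 * (z.re * d.re + z.im * d.im)) 0 := by
  have e : (fun t : ℝ => ‖z + t * d‖ ^ 2) =
      fun t : ℝ => (z.re + t * d.re) * (z.re + t * d.re) + (z.im + t * d.im) * (z.im + t * d.im) := by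
    funext t
    rw [Complex.sq_norm, Complex.normSq_apply]
    simp
  rw [e]
  have h1 : HasDerivAt (fun t : ℝ => z.re + t * d.re) d.re 0 := by
    simpa using ((hasDerivAt_id (0 : ℝ)).mul_const d.re).const_add z.re
  have h2 : HasDerivAt (fun t : ℝ => z.im + t * d.im) d.im 0 := by
    simpa using ((hasDerivAt_id (0 : ℝ)).mul_const d.im).const_add z.im
  refine ((h1.mul h1).add (h2.mul h2)).congr_deriv ?_
  ring

/-- The chain rule fails at z = 0, but t² log t² still has derivative 0 there. Zero coordinates of a
maximizer thus need no separate variation argument. -/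
lemma hasDerivAt_mul_log_norm_sq (z d : ℂ) (hd : ‖d‖ = 1) :
    HasDerivAt (fun t : ℝ => ‖z + t * d‖ ^ 2 * log (‖z + t * d‖ ^ 2))
      ((log (‖z‖ ^ 2) + 1) * (2 * (z.re * d.re + z.im * d.im))) 0 := by
  by_cases hz : z = 0
  · subst hz
    have e : (fun t : ℝ => ‖0 + t * d‖ ^ 2 * log (‖0 + t * d‖ ^ 2)) =
        fun t : ℝ => t ^ 2 * log (t ^ 2) := by
      funext t
      rw [zero_add, norm_mul, hd, mul_one, Complex.norm_real, Real.norm_eq_abs, sq_abs]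
    rw [e]
    simpa using hasDerivAt_sq_mul_log_sq
  · have h := hasDerivAt_norm_add_smul_sq z d
    have h2 : HasDerivAt (fun u : ℝ => u * log u) (log (‖z‖ ^ 2) + 1)
        (‖z + ((0 : ℝ) : ℂ) * d‖ ^ 2) := by
      have := Real.hasDerivAt_mul_log (x := ‖z‖ ^ 2) (by simpa using hz)
      simpa using this
    exact h2.comp (0 : ℝ) h

-- The variational problem on the unit sphere

section
variable {ι : Type*} [Fintype ι]

/-- `∑ u_j log u_j - N log N` with `N = ∑ u_j`: minus the unnormalized entropy of `u`. -/
def negEntropy (u : ι → ℝ) : ℝ := ∑ j, u j * log (u j) - (∑ j, u j) * log (∑ j, u j)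

lemma negEntropy_smul (u : ι → ℝ) {s : ℝ} (hs : s ≠ 0) :
    negEntropy (fun j => s * u j) = s * negEntropy u := by
  have hx : ∀ a : ℝ, s * a * log (s * a) = s * log s * a + s * (a * log a) := by
    intro a
    by_cases ha : a = 0
    · simp [ha]
    · rw [Real.log_mul hs ha]; ring
  unfold negEntropy
  simp_rw [hx]
  rw [← Finset.mul_sum, hx, Finset.sum_add_distrib, ← Finset.mul_sum, ← Finset.mul_sum]
  ring

/-- The maximum c exists by compactness of the unit sphere; homogeneity of degree two in y carries
the bound to all vectors. -/
lemma exists_maximizer [Nonempty ι] (μ : ℝ) :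
    ∃ (x : ι → ℂ) (c : ℝ), ∑ j, ‖x j‖ ^ 2 = 1 ∧
      negEntropy (fun j => ‖x j‖ ^ 2) - μ * ‖∑ j, x j‖ ^ 2 = c ∧
      ∀ y : ι → ℂ, negEntropy (fun j => ‖y j‖ ^ 2) - μ * ‖∑ j, y j‖ ^ 2 ≤
        c * ∑ j, ‖y j‖ ^ 2 := by
  classical
  set K : Set (ι → ℂ) := {x | ∑ j, ‖x j‖ ^ 2 = 1}
  have hK : IsCompact K := by
    refine Metric.isCompact_of_isClosed_isBounded
      (isClosed_eq (by fun_prop) continuous_const) ?_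
    refine (Metric.isBounded_closedBall (x := 0) (r := 1)).subset ?_
    intro x hx
    rw [mem_closedBall_zero_iff, pi_norm_le_iff_of_nonneg zero_le_one]
    intro j
    have h1 : ‖x j‖ ^ 2 ≤ 1 := by
      rw [← show ∑ j, ‖x j‖ ^ 2 = 1 from hx]
      exact Finset.single_le_sum (f := fun j => ‖x j‖ ^ 2) (fun _ _ => sq_nonneg _)
        (Finset.mem_univ j)
    nlinarith [norm_nonneg (x j)]
  have hne : K.Nonempty := by
    refine ⟨Pi.single (Classical.arbitrary ι) 1, ?_⟩
    show ∑ j, ‖(Pi.single (Classical.arbitrary ι) 1 : ι → ℂ) j‖ ^ 2 = 1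
    rw [Finset.sum_eq_single (Classical.arbitrary ι)]
    · simp
    · intro j _ hj; simp [hj]
    · simp
  have hcont : Continuous fun x : ι → ℂ =>
      negEntropy (fun j => ‖x j‖ ^ 2) - μ * ‖∑ j, x j‖ ^ 2 := by
    have hxi := Real.continuous_mul_log
    have h1 : ∀ j, Continuous fun x : ι → ℂ => ‖x j‖ ^ 2 * log (‖x j‖ ^ 2) := fun j =>
      hxi.comp (by fun_prop : Continuous fun x : ι → ℂ => ‖x j‖ ^ 2)
    have h2 : Continuous fun x : ι → ℂ => (∑ j, ‖x j‖ ^ 2) * log (∑ j, ‖x j‖ ^ 2) :=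
      hxi.comp (by fun_prop : Continuous fun x : ι → ℂ => ∑ j, ‖x j‖ ^ 2)
    unfold negEntropy
    exact ((continuous_finsetSum _ fun j _ => h1 j).sub h2).sub (by fun_prop)
  obtain ⟨x, hx, hmax⟩ := hK.exists_isMaxOn hne hcont.continuousOn
  refine ⟨x, _, hx, rfl, fun y => ?_⟩
  set N := ∑ j, ‖y j‖ ^ 2 with hN
  have hN0 : 0 ≤ N := Finset.sum_nonneg fun _ _ => sq_nonneg _
  rcases hN0.eq_or_lt with h0 | h0
  · have hy : y = 0 := by
      funext j
      have := (Finset.sum_eq_zero_iff_of_nonneg fun j _ => sq_nonneg ‖y j‖).1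
        (by rw [← hN, ← h0]) j (Finset.mem_univ j)
      simpa using this
    rw [← h0, hy]
    simp [negEntropy]
  · have hs : (√N) ≠ 0 := (Real.sqrt_pos.2 h0).ne'
    have hss : √N ^ 2 = N := Real.sq_sqrt hN0
    have hnorm : ∀ z : ℂ, ‖((√N)⁻¹ : ℂ) * z‖ ^ 2 = N⁻¹ * ‖z‖ ^ 2 := by
      intro z
      rw [norm_mul, mul_pow, norm_inv, Complex.norm_real, Real.norm_eq_abs, inv_pow, sq_abs, hss]
    have hmem : (fun j => ((√N)⁻¹ : ℂ) * y j) ∈ K := by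
      show ∑ j, ‖((√N)⁻¹ : ℂ) * y j‖ ^ 2 = 1
      simp_rw [hnorm]
      rw [← Finset.mul_sum, ← hN, inv_mul_cancel₀ h0.ne']
    have hle := isMaxOn_iff.1 hmax _ hmem
    simp_rw [hnorm] at hle
    rw [negEntropy_smul _ (inv_ne_zero h0.ne'), ← Finset.mul_sum,
      hnorm] at hle
    have h3 := mul_le_mul_of_nonneg_right hle h0.le
    have h4 : N⁻¹ * N = 1 := inv_mul_cancel₀ h0.ne'
    refine le_trans (le_of_eq ?_) h3
    linear_combination (-(negEntropy (fun j => ‖y j‖ ^ 2) - μ * ‖∑ j, y j‖ ^ 2)) * h4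

/-- The Lagrange condition, with the maximum c as multiplier. Only coordinate j moves; the
directions 1 and i yield the real and imaginary parts, and the constants from differentiating u log
u cancel between the entry and the total. -/
lemma stationary_of_maximizer {μ c : ℝ} {x : ι → ℂ} (hx : ∑ j, ‖x j‖ ^ 2 = 1)
    (hc : negEntropy (fun j => ‖x j‖ ^ 2) - μ * ‖∑ j, x j‖ ^ 2 = c)
    (hmax : ∀ y : ι → ℂ, negEntropy (fun j => ‖y j‖ ^ 2) - μ * ‖∑ j, y j‖ ^ 2 ≤
        c * ∑ j, ‖y j‖ ^ 2) (j : ι) :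
    ((log (‖x j‖ ^ 2) - c : ℝ) : ℂ) * x j = μ * ∑ i, x i := by
  classical
  have hdir : ∀ d : ℂ, ‖d‖ = 1 → (log (‖x j‖ ^ 2) - c) * ((x j).re * d.re + (x j).im * d.im) =
      μ * ((∑ i, x i).re * d.re + (∑ i, x i).im * d.im) := by
    intro d hd
    set S := ∑ i, x i with hS
    set w : ℝ → ℝ := fun t => ‖x j + t * d‖ ^ 2 with hw
    set Nt : ℝ → ℝ := fun t => w t + (1 - ‖x j‖ ^ 2) with hNt
    set E := ∑ i ∈ Finset.univ.erase j, ‖x i‖ ^ 2 * log (‖x i‖ ^ 2) with hE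
    have hw0 : w 0 = ‖x j‖ ^ 2 := by simp [hw]
    have hN0 : Nt 0 = 1 := by simp [hNt, hw0]
    have hsplit : ∀ (f : ι → ℝ), ∑ i, f i = f j + ∑ i ∈ Finset.univ.erase j, f i := fun f =>
      (Finset.add_sum_erase _ f (Finset.mem_univ j)).symm
    let k : ℝ → ℝ := fun t => w t * log (w t) + E - Nt t * log (Nt t) - μ * ‖S + t * d‖ ^ 2
      - c * Nt t
    have hk : ∀ t, k t ≤ k 0 := by
      intro t
      have hsum1 : ∀ f : ℂ → ℝ, ∑ i, f (Function.update x j (x j + t * d) i) =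
          f (x j + t * d) + ∑ i ∈ Finset.univ.erase j, f (x i) := by
        intro f
        rw [hsplit]
        congr 1
        · simp
        · refine Finset.sum_congr rfl fun i hi => ?_
          rw [Function.update_of_ne (Finset.ne_of_mem_erase hi)]
      have hN : ∑ i, ‖Function.update x j (x j + t * d) i‖ ^ 2 = Nt t := by
        rw [hsum1 (fun z => ‖z‖ ^ 2)]
        have := hsplit (fun i => ‖x i‖ ^ 2)
        simp only [hNt, hw]
        linarith
      have hSu : ∑ i, Function.update x j (x j + t * d) i = S + t * d := by
        rw [Finset.sum_update_of_mem (Finset.mem_univ j), hS,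
          ← Finset.add_sum_erase _ x (Finset.mem_univ j), Finset.sdiff_singleton_eq_erase]
        ring
      have h := hmax (Function.update x j (x j + t * d))
      unfold negEntropy at h
      rw [hN, hSu, hsum1 (fun z => ‖z‖ ^ 2 * log (‖z‖ ^ 2))] at h
      have h0 : k 0 = 0 := by
        simp only [k, hw0, hN0]
        unfold negEntropy at hc
        rw [hx, hsplit] at hc
        simp only [Complex.ofReal_zero, zero_mul, add_zero]
        simp only [Real.log_one, mul_zero, sub_zero, mul_one] at hc ⊢
        linarith
      rw [h0]
      simp only [k]
      linarith
    have hdw := hasDerivAt_norm_add_smul_sq (x j) d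
    have hdNt : HasDerivAt Nt (2 * ((x j).re * d.re + (x j).im * d.im)) 0 := hdw.add_const _
    have hdN : HasDerivAt (fun t => Nt t * log (Nt t))
        ((log 1 + 1) * (2 * ((x j).re * d.re + (x j).im * d.im))) 0 := by
      have h2 : HasDerivAt (fun u : ℝ => u * log u) (log 1 + 1) (Nt 0) := by
        rw [hN0]; exact Real.hasDerivAt_mul_log one_ne_zero
      exact h2.comp (0 : ℝ) hdNt
    have hdk : HasDerivAt k _ 0 :=
      ((((hasDerivAt_mul_log_norm_sq (x j) d hd).add_const E).sub hdN).sub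
        ((hasDerivAt_norm_add_smul_sq S d).const_mul μ)).sub (hdNt.const_mul c)
    have hmaxk : IsLocalMax k 0 := Filter.Eventually.of_forall hk
    have := hmaxk.hasDerivAt_eq_zero hdk
    rw [Real.log_one] at this
    linarith
  have h1 := hdir 1 (by simp)
  have hI := hdir Complex.I (by simp)
  apply Complex.ext
  · simpa using h1
  · simpa using hI

/-- The quadratic majorant of the negative entropy of `|x_j|²` that touches it at
`(1, -β, …, -β)`. -/
theorem negEntropy_le {n β : ℝ} (hcard : (Fintype.card ι : ℝ) = n + 1) (hn : 1 ≤ n)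
    (h0 : 0 < β) (h1 : n * β < 1) (hcoef : -log 2 ≤ constCoef n β) (y : ι → ℂ) :
    negEntropy (fun j => ‖y j‖ ^ 2) ≤
      constCoef n β * ∑ j, ‖y j‖ ^ 2 + sumCoef n β * ‖∑ j, y j‖ ^ 2 := by
  classical
  have : Nonempty ι := by
    rw [← Fintype.card_pos_iff]
    have : (0 : ℝ) < Fintype.card ι := by rw [hcard]; linarith
    exact_mod_cast this
  set μ := sumCoef n β with hμdef
  have hμ : 0 < μ := sumCoef_pos hn h0 h1
  obtain ⟨x, c, hx, hc, hmax⟩ := exists_maximizer (ι := ι) μ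
  suffices hle : c ≤ constCoef n β by
    have h3 := hmax y
    have : c * ∑ j, ‖y j‖ ^ 2 ≤ constCoef n β * ∑ j, ‖y j‖ ^ 2 :=
      mul_le_mul_of_nonneg_right hle (Finset.sum_nonneg fun _ _ => sq_nonneg _)
    linarith
  by_contra hlt
  push Not at hlt
  have hc2 : -log 2 < c := hcoef.trans_lt hlt
  have hst := stationary_of_maximizer hx hc hmax
  have hec : exp (-c) < 2 := by
    rw [← Real.exp_log two_pos]
    exact Real.exp_lt_exp.2 (by linarith)
  by_cases hS : ∑ i, x i = 0
  · -- all nonzero entries have the same modulus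
    have hmod : ∀ j, x j ≠ 0 → ‖x j‖ ^ 2 = exp c := by
      intro j hj
      have h := hst j
      rw [hS, mul_zero] at h
      rcases mul_eq_zero.1 h with h | h
      · have h5 : log (‖x j‖ ^ 2) = c := by
          have := Complex.ofReal_eq_zero.1 h
          linarith
        rw [← h5, Real.exp_log]
        have := norm_pos_iff.2 hj
        positivity
      · exact absurd h hj
    obtain ⟨i, hi⟩ : ∃ i, x i ≠ 0 := by
      by_contra hall
      push Not at hall
      simp [hall] at hx
    obtain ⟨j, hji, hj⟩ : ∃ j, j ≠ i ∧ x j ≠ 0 := by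
      by_contra hall
      push Not at hall
      rw [Finset.sum_eq_single i (fun j _ hj => hall j hj) (by simp)] at hS
      exact hi hS
    -- Two entries of squared modulus exp c fit into a unit vector only if c ≤ -log 2.
    have h2 : ‖x i‖ ^ 2 + ‖x j‖ ^ 2 ≤ 1 := by
      rw [← hx, ← Finset.sum_pair (f := fun j => ‖x j‖ ^ 2) (Ne.symm hji)]
      exact Finset.sum_le_sum_of_subset_of_nonneg (Finset.subset_univ _) fun _ _ _ => sq_nonneg _
    rw [hmod i hi, hmod j hj] at h2
    have h3 : exp (-c) * exp c = 1 := by rw [← Real.exp_add]; simp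
    have := Real.exp_pos c
    nlinarith
  · set S := ∑ i, x i with hSdef
    set s := ‖S‖ with hs
    have hs0 : 0 < s := norm_pos_iff.2 hS
    have hsC : (s : ℂ) ≠ 0 := by exact_mod_cast hs0.ne'
    have hne : ∀ j, log (‖x j‖ ^ 2) - c ≠ 0 := by
      intro j h
      have h2 := hst j
      rw [h, Complex.ofReal_zero, zero_mul] at h2
      rcases mul_eq_zero.1 h2.symm with h | h
      · exact hμ.ne' (by exact_mod_cast h)
      · exact hS h
    -- Stationarity makes every entry a real multiple of the common phase S/s.
    set r : ι → ℝ := fun j => μ * s / (log (‖x j‖ ^ 2) - c) with hr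
    have hxr : ∀ j, x j = r j * (S / s) := by
      intro j
      have h2 := hst j
      have h3 : ((log (‖x j‖ ^ 2) - c : ℝ) : ℂ) ≠ 0 := by exact_mod_cast hne j
      have h4 : x j = μ * S / ((log (‖x j‖ ^ 2) - c : ℝ) : ℂ) := by
        rw [eq_div_iff h3, mul_comm, h2]
      rw [h4, hr]
      push_cast
      field_simp
    have hnorm : ∀ j, ‖x j‖ ^ 2 = r j ^ 2 := by
      intro j
      conv_lhs => rw [hxr j]
      rw [norm_mul, norm_div, Complex.norm_real, Complex.norm_real, ← hs, Real.norm_eq_abs,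
        Real.norm_eq_abs, abs_of_pos hs0, div_self hs0.ne', mul_one, sq_abs]
    have hrst : ∀ j, r j * (log (r j ^ 2) - c) = μ * s := by
      intro j
      rw [← hnorm j]
      simp only [hr]
      exact div_mul_cancel₀ _ (hne j)
    have hrsum : ∑ j, r j = s := by
      have h2 : (∑ j, (r j : ℂ)) * (S / s) = S := by
        rw [Finset.sum_mul, hSdef]
        exact Finset.sum_congr rfl fun j _ => (hxr j).symm
      have h3 : ((∑ j, r j : ℝ) : ℂ) = s := by
        push_cast
        field_simp at h2
        exact mul_right_cancel₀ hS (by rw [h2, mul_comm])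
      exact_mod_cast h3
    have hrsq : ∑ j, r j ^ 2 = 1 := by
      rw [← hx]
      exact Finset.sum_congr rfl fun j _ => (hnorm j).symm
    have hr0 : ∀ j, r j ≠ 0 := by
      intro j h
      have := hrst j
      rw [h, zero_mul] at this
      exact (mul_pos hμ hs0).ne this
    -- rescaling
    set q := exp (-c / 2) with hq
    have hq0 : 0 < q := Real.exp_pos _
    have hqq : q ^ 2 = exp (-c) := by
      rw [hq, sq, ← Real.exp_add]; congr 1; ring
    -- The factor q = exp(-c/2) absorbs c into the logarithm, and the squares of the q r_j add up to
    -- exp(-c) < 2.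
    obtain ⟨i, hi, α, hα, hothers⟩ := eq_const_of_mul_log_eq (z := fun j => q * r j)
      (v := q * (μ * s) / 2) (by positivity)
      (by
        intro j
        rw [Real.log_mul hq0.ne' (hr0 j), hq, Real.log_exp, ← hq, ← hrst j, Real.log_pow]
        push_cast
        ring)
      (by rw [← Finset.mul_sum, hrsum]; positivity)
      (by simp_rw [mul_pow]; rw [← Finset.mul_sum, hrsq, hqq, mul_one]; exact hec)
    have hX : 0 < r i := by
      by_contra h
      push Not at h
      nlinarith
    set X := r i with hXdef
    set t := α / (q * X) with ht
    have ht0 : 0 < t := by positivity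
    have hrj : ∀ j, j ≠ i → r j = -(t * X) := by
      intro j hj
      have h2 := hothers j hj
      rw [ht]
      field_simp
      linarith
    have hcardE : ((Finset.univ.erase i).card : ℝ) = n := by
      rw [Finset.card_erase_of_mem (Finset.mem_univ i), Finset.card_univ,
        Nat.cast_sub Fintype.card_pos, hcard]
      simp
    have hsum_eq : ∀ f : ℝ → ℝ, ∑ j, f (r j) = f X + n * f (-(t * X)) := by
      intro f
      rw [← Finset.add_sum_erase _ _ (Finset.mem_univ i), ← hcardE, ← nsmul_eq_mul,
        ← Finset.sum_const]
      congr 1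
      refine Finset.sum_congr rfl fun j hj => ?_
      rw [hrj j (Finset.ne_of_mem_erase hj)]
    have hs_eq : s = X * (1 - n * t) := by
      rw [← hrsum, hsum_eq (fun u => u)]; ring
    have hN_eq : X ^ 2 * (1 + n * t ^ 2) = 1 := by
      have h2 := hsum_eq (fun u => u ^ 2)
      rw [hrsq] at h2
      linear_combination -h2
    have hnt : 0 < 1 - n * t := by
      by_contra h
      push Not at h
      nlinarith
    obtain ⟨j, hj⟩ : ∃ j, j ≠ i := by
      by_contra hall
      push Not at hall
      have h4 : Fintype.card ι ≤ 1 := by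
        rw [Fintype.card_le_one_iff]
        intro a b; rw [hall a, hall b]
      have h5 : (Fintype.card ι : ℝ) ≤ 1 := by exact_mod_cast h4
      linarith
    have e1 : log (X ^ 2) - c = μ * (1 - n * t) := by
      have h2 := hrst i
      rw [← hXdef, hs_eq] at h2
      exact mul_left_cancel₀ hX.ne' (by linarith)
    have e2 : t * (2 * log t + log (X ^ 2) - c) = -(μ * (1 - n * t)) := by
      have h2 := hrst j
      rw [hrj j hj, hs_eq, neg_sq, mul_pow, Real.log_mul (by positivity) (by positivity),
        Real.log_pow t] at h2
      push_cast at h2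
      refine mul_left_cancel₀ hX.ne' ?_
      linear_combination -h2
    -- Eliminating log X² between the two stationarity equations leaves this relation; injectivity
    -- of `sumCoef n` then forces t = β.
    have e3 : sumCoef n t = μ := by
      unfold sumCoef
      rw [div_eq_iff (by positivity)]
      linear_combination -e2 + t * e1
    have hn0 : 0 < n := by linarith
    have htβ : t = β := by
      refine (sumCoef_strictMonoOn hn).injOn ⟨ht0, ?_⟩ ⟨h0, ?_⟩ e3
      · rw [lt_div_iff₀ hn0]; linarith
      · rw [lt_div_iff₀ hn0]; linarith
    have hlog : log (X ^ 2) = -log (1 + n * t ^ 2) := by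
      have h6 : 0 < 1 + n * t ^ 2 := by positivity
      have := congrArg Real.log hN_eq
      rw [Real.log_mul (by positivity) h6.ne', Real.log_one] at this
      linarith
    have : c = constCoef n β := by
      have hp1 : 1 + t ≠ 0 := by positivity
      have hp2 : 1 - n * t ≠ 0 := hnt.ne'
      have h7 : μ * (1 - n * t) = -(2 * (t * log t) / (1 + t)) := by
        rw [← e3]; unfold sumCoef
        rw [div_mul_eq_mul_div, mul_div_mul_right _ _ hp2, neg_div]
      rw [← htβ]
      unfold constCoef
      linarith
    exact hlt.ne' this

end

end QPyramid

end

noncomputable section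

namespace QPyramid

open Real

/-! ### Further properties of the negative entropy -/

section
variable {ι : Type*} [Fintype ι]

/-- The tangent bound log x ≤ x - 1 at x = Nq/u: one term of the Gibbs inequality against a
reference weight q. -/
lemma mul_log_gibbs {u N q : ℝ} (hu : 0 ≤ u) (hN : 0 ≤ N) (hq : 0 ≤ q)
    (hNu : 0 < u → 0 < N ∧ 0 < q) : u * log q + u - N * q ≤ u * log u - u * log N := by
  rcases hu.eq_or_lt with h | h
  · rw [← h]
    have := mul_nonneg hN hq
    simp only [zero_mul]
    linarith
  · obtain ⟨hN0, hq0⟩ := hNu h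
    have h1 := Real.log_le_sub_one_of_pos (show 0 < N * q / u by positivity)
    rw [Real.log_div (by positivity) h.ne', Real.log_mul hN0.ne' hq0.ne'] at h1
    have h2 := mul_le_mul_of_nonneg_left h1 hu
    have h3 : u * (N * q / u - 1) = N * q - u := by field_simp
    linarith

lemma negEntropy_eq_sum (u : ι → ℝ) :
    negEntropy u = ∑ j, (u j * log (u j) - u j * log (∑ i, u i)) := by
  unfold negEntropy
  rw [Finset.sum_sub_distrib, Finset.sum_mul]

lemma sum_pos_of_pos {u : ι → ℝ} (hu : ∀ j, 0 ≤ u j) {j : ι} (hj : 0 < u j) : 0 < ∑ i, u i :=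
  Finset.sum_pos' (fun i _ => hu i) ⟨j, Finset.mem_univ j, hj⟩

/-- Gibbs' inequality for each u l against the normalized total U/T. It reduces general observables
to rank-one pieces. -/
lemma negEntropy_sum_le {κ : Type*} (s : Finset κ) (u : κ → ι → ℝ) (hu : ∀ l j, 0 ≤ u l j) :
    negEntropy (fun j => ∑ l ∈ s, u l j) ≤ ∑ l ∈ s, negEntropy (u l) := by
  set U : ι → ℝ := fun j => ∑ l ∈ s, u l j with hU
  have hU0 : ∀ j, 0 ≤ U j := fun j => Finset.sum_nonneg fun l _ => hu l j
  set T := ∑ j, U j with hT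
  have hT0 : 0 ≤ T := Finset.sum_nonneg fun j _ => hU0 j
  have hdiv : ∑ j, U j / T = 1 ∨ T = 0 := by
    by_cases h : T = 0
    · exact Or.inr h
    · left; rw [← Finset.sum_div, ← hT, div_self h]
  have hterm : ∀ l ∈ s, ∑ j, u l j * log (U j / T) ≤ negEntropy (u l) := by
    intro l hl
    have hle : ∀ j, u l j ≤ U j := fun j =>
      Finset.single_le_sum (f := fun l => u l j) (fun l _ => hu l j) hl
    have h1 : ∀ j, u l j * log (U j / T) + u l j - (∑ i, u l i) * (U j / T) ≤
        u l j * log (u l j) - u l j * log (∑ i, u l i) := by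
      intro j
      refine mul_log_gibbs (hu l j) (Finset.sum_nonneg fun i _ => hu l i)
        (div_nonneg (hU0 j) hT0) fun hpos => ⟨sum_pos_of_pos (hu l) hpos, ?_⟩
      have : 0 < U j := hpos.trans_le (hle j)
      exact div_pos this (sum_pos_of_pos hU0 this)
    have h2 := Finset.sum_le_sum fun j (_ : j ∈ Finset.univ) => h1 j
    rw [← negEntropy_eq_sum, Finset.sum_sub_distrib, Finset.sum_add_distrib,
      ← Finset.mul_sum] at h2
    rcases hdiv with h | h
    · rw [h, mul_one] at h2
      linarith
    · have : ∀ j, u l j = 0 := by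
        intro j
        have h3 := (Finset.sum_eq_zero_iff_of_nonneg fun j _ => hU0 j).1 h j (Finset.mem_univ j)
        exact le_antisymm (h3 ▸ hle j) (hu l j)
      simp [this, negEntropy]
  calc negEntropy U = ∑ l ∈ s, ∑ j, u l j * log (U j / T) := by
        have hcomm : ∑ l ∈ s, ∑ j, u l j * log (U j / T) =
            ∑ j, ∑ l ∈ s, u l j * log (U j / T) := Finset.sum_comm
        rw [negEntropy_eq_sum, hcomm]
        refine Finset.sum_congr rfl fun j _ => ?_
        rw [← Finset.sum_mul]
        rcases (hU0 j).eq_or_lt with h | h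
        · rw [← h]; simp only [hU] at h; simp [← h]
        · rw [Real.log_div h.ne' (sum_pos_of_pos hU0 h).ne']
          simp only [hU]; ring
    _ ≤ ∑ l ∈ s, negEntropy (u l) := Finset.sum_le_sum hterm

lemma negEntropy_nonpos {u : ι → ℝ} (hu : ∀ j, 0 ≤ u j) : negEntropy u ≤ 0 := by
  rw [negEntropy_eq_sum]
  refine Finset.sum_nonpos fun j _ => ?_
  rcases (hu j).eq_or_lt with h | h
  · rw [← h]; simp
  · have : log (u j) ≤ log (∑ i, u i) :=
      Real.log_le_log h (Finset.single_le_sum (fun i _ => hu i) (Finset.mem_univ j))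
    have := mul_le_mul_of_nonneg_left this h.le
    linarith

/-- The majorant of `negEntropy_le`, including the degenerate parameters `β = 0` and
`β = 1 / n`. -/
theorem negEntropy_le_of_mem_Icc {n β : ℝ} (hcard : (Fintype.card ι : ℝ) = n + 1) (hn : 1 ≤ n)
    (h0 : 0 ≤ β) (h1 : n * β ≤ 1) (hcoef : -log 2 ≤ constCoef n β) (y : ι → ℂ)
    (hy : n * β = 1 → ∑ j, y j = 0) :
    negEntropy (fun j => ‖y j‖ ^ 2) ≤
      constCoef n β * ∑ j, ‖y j‖ ^ 2 + sumCoef n β * ‖∑ j, y j‖ ^ 2 := by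
  have hn0 : 0 < n := by linarith
  rcases h0.eq_or_lt with h | h
  -- At β = 0 both coefficients vanish, because 0 log 0 = 0.
  · rw [← h]
    have := negEntropy_nonpos (u := fun j => ‖y j‖ ^ 2) fun _ => sq_nonneg _
    simpa [constCoef, sumCoef] using this
  rcases h1.lt_or_eq with h' | h'
  · exact negEntropy_le hcard hn h h' hcoef y
  -- Here `sumCoef` has a zero denominator, but it multiplies a zero sum. The bound is the limit b ↑
  -- β, where `constCoef n b` is larger and so stays admissible.
  have hβ : β = 1 / n := by field_simp; linarith
  have hS := hy h'
  rw [hS]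
  have hev : ∀ b ∈ Set.Ioo 0 β, negEntropy (fun j => ‖y j‖ ^ 2) ≤
      constCoef n b * ∑ j, ‖y j‖ ^ 2 := by
    intro b hb
    have hb1 : n * b < 1 := by nlinarith [hb.2]
    have hanti := constCoef_strictAntiOn hn ⟨hb.1.le, by rw [← hβ]; exact hb.2.le⟩
      ⟨h0, hβ.le⟩ hb.2
    have := negEntropy_le hcard hn hb.1 hb1 (hcoef.trans hanti.le) y
    simpa [hS] using this
  have hlim : Filter.Tendsto (fun b => constCoef n b * ∑ j, ‖y j‖ ^ 2)
      (nhdsWithin β (Set.Iio β)) (nhds (constCoef n β * ∑ j, ‖y j‖ ^ 2)) :=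
    (((continuousAt_constCoef hn0.le h0).tendsto.mono_left nhdsWithin_le_nhds).mul_const _)
  have := ge_of_tendsto hlim (Filter.mem_of_superset (Ioo_mem_nhdsLT h) hev)
  simpa using this

lemma sum_ite_const [DecidableEq ι] {n a b : ℝ} (hcard : (Fintype.card ι : ℝ) = n + 1) (k : ι) :
    ∑ j, (if j = k then a else b) = a + n * b := by
  rw [← Finset.add_sum_erase _ _ (Finset.mem_univ k), if_pos rfl,
    Finset.sum_congr rfl (g := fun _ => b) fun j hj => if_neg (Finset.ne_of_mem_erase hj),
    Finset.sum_const, nsmul_eq_mul, Finset.card_erase_of_mem (Finset.mem_univ k),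
    Finset.card_univ, Nat.cast_sub (Fintype.card_pos_iff.2 ⟨k⟩), hcard]
  simp

lemma constCoef_mul_add_sumCoef_mul {n β : ℝ} (h0 : 0 ≤ β) :
    constCoef n β * (1 + n * β ^ 2) + sumCoef n β * (1 - n * β) ^ 2 =
      n * (β ^ 2 * (2 * log β)) - (1 + n * β ^ 2) * log (1 + n * β ^ 2) := by
  unfold constCoef sumCoef
  have h1 : 1 + β ≠ 0 := by positivity
  by_cases h : 1 - n * β = 0
  · have hnb : n * β = 1 := by linarith
    rw [h]
    have h2 : 1 + n * β ^ 2 = 1 + β := by linear_combination β * hnb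
    rw [h2]
    field_simp
    linear_combination -(2 * β * log β + 2 * β ^ 2 * log β) * hnb
  · field_simp
    ring

lemma negEntropy_touch [DecidableEq ι] {n β : ℝ} (hcard : (Fintype.card ι : ℝ) = n + 1)
    (h0 : 0 ≤ β) (k : ι) :
    negEntropy (fun j => if j = k then 1 else β ^ 2) =
      constCoef n β * (1 + n * β ^ 2) + sumCoef n β * (1 - n * β) ^ 2 := by
  unfold negEntropy
  have e : ∀ j, (if j = k then (1 : ℝ) else β ^ 2) * log (if j = k then 1 else β ^ 2) =
      if j = k then 0 else β ^ 2 * (2 * log β) := by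
    intro j
    split_ifs <;> simp [Real.log_pow]
  simp_rw [e]
  rw [sum_ite_const hcard, sum_ite_const hcard, constCoef_mul_add_sumCoef_mul h0, zero_add]

end

/-! ### Information of an observable for a pyramid -/

section
variable {m : ℕ} {H : Type*} [NormedAddCommGroup H] [InnerProductSpace ℂ H]

/-- The quadratic form of the operator `M`. -/
def quadForm (M : H →L[ℂ] H) (v : H) : ℝ := (inner ℂ v (M v)).re

lemma quadForm_nonneg {M : H →L[ℂ] H} (hM : M.IsPositive) (v : H) : 0 ≤ quadForm M v :=
  hM.re_inner_nonneg_right v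

lemma quadForm_sum {κ : Type*} (s : Finset κ) (M : κ → H →L[ℂ] H) (v : H) :
    quadForm (∑ k ∈ s, M k) v = ∑ k ∈ s, quadForm (M k) v := by
  simp [quadForm]

lemma quadForm_id (v : H) : quadForm (ContinuousLinearMap.id ℂ H) v = ‖v‖ ^ 2 := by
  rw [quadForm, ContinuousLinearMap.id_apply]
  exact inner_self_eq_norm_sq (𝕜 := ℂ) v

lemma quadForm_rankOne (u v : H) :
    quadForm (InnerProductSpace.rankOne ℂ u u) v = ‖inner ℂ v u‖ ^ 2 := by
  rw [quadForm, InnerProductSpace.rankOne_apply, inner_smul_right, ← inner_conj_symm,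
    Complex.conj_mul', ← Complex.ofReal_pow, Complex.ofReal_re]

lemma quadForm_smul (a : ℝ) (M : H →L[ℂ] H) (v : H) :
    quadForm ((a : ℂ) • M) v = a * quadForm M v := by
  simp [quadForm]

variable {κ : Type*}

lemma IsObservable.sum_quadForm [Fintype κ] {M : κ → H →L[ℂ] H} (hM : IsObservable M) (v : H) :
    ∑ k, quadForm (M k) v = ‖v‖ ^ 2 := by
  rw [← quadForm_sum, hM.2, quadForm_id]

lemma sum_basis_eq (e : OrthonormalBasis (Fin m) ℂ H) (hm : 2 ≤ m) :
    ∑ j, e j = ((√(m : ℝ) : ℝ) : ℂ) • axis e := by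
  have h0 : (0 : ℝ) < m := by exact_mod_cast (by omega : 0 < m)
  unfold axis
  rw [smul_smul, ← Complex.ofReal_mul, mul_one_div, div_self (Real.sqrt_pos.2 h0).ne',
    Complex.ofReal_one, one_smul]

lemma norm_axis (e : OrthonormalBasis (Fin m) ℂ H) (hm : 2 ≤ m) : ‖axis e‖ = 1 := by
  have h := inner_self_eq_norm_sq (𝕜 := ℂ) (axis e)
  rw [inner_axis_axis e hm] at h
  have h2 : ‖axis e‖ ^ 2 = 1 := by rw [← h]; simp
  nlinarith [norm_nonneg (axis e)]

lemma sum_edge (e : OrthonormalBasis (Fin m) ℂ H) (hm : 2 ≤ m) (r0 r1 : ℝ) :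
    ∑ j, edge e r0 r1 j = ((m * √r0 : ℝ) : ℂ) • axis e := by
  have h0 : (0 : ℝ) < m := by exact_mod_cast (by omega : 0 < m)
  have h2 : √(m : ℝ) * √(m : ℝ) = m := Real.mul_self_sqrt h0.le
  unfold edge
  rw [Finset.sum_add_distrib, ← Finset.smul_sum, sum_basis_eq e hm, Finset.sum_const,
    Finset.card_univ, Fintype.card_fin, ← Nat.cast_smul_eq_nsmul ℂ, smul_smul, smul_smul,
    ← add_smul]
  congr 1
  rw [Real.sqrt_mul h0.le]
  have h3 : ((√(m : ℝ) : ℝ) : ℂ) * ((√(m : ℝ) : ℝ) : ℂ) = m := by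
    rw [← Complex.ofReal_mul, h2]; simp
  push_cast
  linear_combination (√r1 : ℂ) * h3

lemma norm_edge (e : OrthonormalBasis (Fin m) ℂ H) {r0 r1 : ℝ} (hm : 2 ≤ m)
    (h0 : 0 ≤ r0) (h1 : 0 ≤ r1) (hs : r0 + (m - 1) * r1 = 1) (j : Fin m) :
    ‖edge e r0 r1 j‖ ^ 2 = 1 := by
  have h := inner_self_eq_norm_sq (𝕜 := ℂ) (edge e r0 r1 j)
  rw [inner_edge_self e hm h0 h1 hs] at h
  rw [← h]; simp

lemma norm_sum_edge_sq (e : OrthonormalBasis (Fin m) ℂ H) {r0 : ℝ} (r1 : ℝ) (hm : 2 ≤ m)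
    (h0 : 0 ≤ r0) : ‖∑ j, edge e r0 r1 j‖ ^ 2 = m ^ 2 * r0 := by
  rw [sum_edge e hm, norm_smul, norm_axis e hm, mul_one, Complex.norm_real, Real.norm_eq_abs,
    sq_abs, mul_pow, Real.sq_sqrt h0]

/-- Completeness of M turns each quadratic form into a squared norm, so the total no longer depends
on M. -/
lemma sum_majorant [Fintype κ] (e : OrthonormalBasis (Fin m) ℂ H) {r0 r1 : ℝ} (hm : 2 ≤ m)
    (h0 : 0 ≤ r0) (h1 : 0 ≤ r1) (hs : r0 + (m - 1) * r1 = 1) {M : κ → H →L[ℂ] H}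
    (hM : IsObservable M) (c μ : ℝ) :
    ∑ k, (c * ∑ j, quadForm (M k) (edge e r0 r1 j) +
      μ * quadForm (M k) (∑ j, edge e r0 r1 j)) = m * (c + μ * (m * r0)) := by
  rw [Finset.sum_add_distrib, ← Finset.mul_sum, ← Finset.mul_sum, Finset.sum_comm,
    hM.sum_quadForm, norm_sum_edge_sq e r1 hm h0]
  simp_rw [hM.sum_quadForm, norm_edge e hm h0 h1 hs]
  simp
  ring

variable [FiniteDimensional ℂ H]

lemma jointProb_pyramid (e : OrthonormalBasis (Fin m) ℂ H) {r0 r1 : ℝ} (hm : 2 ≤ m)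
    (h0 : 0 ≤ r0) (h1 : 0 ≤ r1) (hs : r0 + (m - 1) * r1 = 1) (M : κ → H →L[ℂ] H)
    (j : Fin m) (k : κ) :
    jointProb (pyramidEnsemble e r0 r1 hm h0 h1 hs) M j k =
      1 / m * quadForm (M k) (edge e r0 r1 j) := by
  have : CompleteSpace H := FiniteDimensional.complete ℂ H
  unfold jointProb pyramidEnsemble quadForm
  simp only
  rw [InnerProductSpace.rankOne_comp, InnerProductSpace.trace_rankOne,
    ContinuousLinearMap.adjoint_inner_left]

variable [Fintype κ]

lemma mutualInfo_term {m w W : ℝ} (hm : 0 < m) (hw : 0 ≤ w) (hW : 0 < w → 0 < W) :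
    1 / m * w * logb 2 (1 / m * w / (1 / m * (1 / m * W))) =
      (1 / (m * log 2)) * (w * log w - w * log W) + 1 / m * w * logb 2 m := by
  rcases hw.eq_or_lt with h | h
  · rw [← h]; simp
  · have hW0 := hW h
    have e : 1 / m * w / (1 / m * (1 / m * W)) = m * w / W := by field_simp
    rw [e, Real.logb, Real.logb, Real.log_div (by positivity) hW0.ne',
      Real.log_mul hm.ne' h.ne']
    have : log 2 ≠ 0 := (Real.log_pos one_lt_two).ne'
    field_simp
    ring

lemma mutualInfo_pyramid (e : OrthonormalBasis (Fin m) ℂ H) {r0 r1 : ℝ} (hm : 2 ≤ m)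
    (h0 : 0 ≤ r0) (h1 : 0 ≤ r1) (hs : r0 + (m - 1) * r1 = 1) {M : κ → H →L[ℂ] H}
    (hM : IsObservable M) :
    mutualInfo (pyramidEnsemble e r0 r1 hm h0 h1 hs) M = logb 2 m +
      1 / (m * log 2) * ∑ k, negEntropy (fun j => quadForm (M k) (edge e r0 r1 j)) := by
  have hm0 : (0 : ℝ) < m := by exact_mod_cast (by omega : 0 < m)
  unfold mutualInfo
  have hprob : ∀ j, (pyramidEnsemble e r0 r1 hm h0 h1 hs).prob j = 1 / (m : ℝ) := fun _ => rfl
  simp only [outcomeProb, jointProb_pyramid, hprob]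
  simp_rw [← Finset.mul_sum]
  have hterm : ∀ j k, 1 / (m : ℝ) * quadForm (M k) (edge e r0 r1 j) *
      logb 2 (1 / (m : ℝ) * quadForm (M k) (edge e r0 r1 j) /
        (1 / (m : ℝ) * (1 / (m : ℝ) * ∑ i, quadForm (M k) (edge e r0 r1 i)))) =
      (1 / (m * log 2)) * (quadForm (M k) (edge e r0 r1 j) *
        log (quadForm (M k) (edge e r0 r1 j)) - quadForm (M k) (edge e r0 r1 j) *
        log (∑ i, quadForm (M k) (edge e r0 r1 i))) +
      1 / m * quadForm (M k) (edge e r0 r1 j) * logb 2 m := fun j k =>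
    mutualInfo_term hm0 (quadForm_nonneg (hM.1 k) _)
      fun h => sum_pos_of_pos (fun i => quadForm_nonneg (hM.1 k) _) h
  simp_rw [hterm, Finset.sum_add_distrib, negEntropy_eq_sum]
  rw [add_comm]
  congr 1
  · simp_rw [← Finset.sum_mul, ← Finset.mul_sum, hM.sum_quadForm, norm_edge e hm h0 h1 hs]
    simp [hm0.ne']
  · rw [Finset.sum_comm]
    simp_rw [← Finset.mul_sum]

/-- A quadratic majorant of the negative entropy bounds the information of every observable. -/
lemma mutualInfo_le_of_majorant (e : OrthonormalBasis (Fin m) ℂ H) {r0 r1 : ℝ} (hm : 2 ≤ m)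
    (h0 : 0 ≤ r0) (h1 : 0 ≤ r1) (hs : r0 + (m - 1) * r1 = 1) {M : κ → H →L[ℂ] H}
    (hM : IsObservable M) {c μ : ℝ}
    (hle : ∀ v : H, negEntropy (fun j => ‖inner ℂ (edge e r0 r1 j) v‖ ^ 2) ≤
      c * ∑ j, ‖inner ℂ (edge e r0 r1 j) v‖ ^ 2 +
        μ * ‖inner ℂ (∑ j, edge e r0 r1 j) v‖ ^ 2) :
    mutualInfo (pyramidEnsemble e r0 r1 hm h0 h1 hs) M ≤
      logb 2 m + (c + μ * (m * r0)) / log 2 := by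
  have hm0 : (0 : ℝ) < m := by exact_mod_cast (by omega : 0 < m)
  have hl2 := Real.log_pos one_lt_two
  rw [mutualInfo_pyramid e hm h0 h1 hs hM]
  have hk : ∀ k, negEntropy (fun j => quadForm (M k) (edge e r0 r1 j)) ≤
      c * ∑ j, quadForm (M k) (edge e r0 r1 j) + μ * quadForm (M k) (∑ j, edge e r0 r1 j) := by
    intro k
    obtain ⟨N, u, hu⟩ := ContinuousLinearMap.isPositive_iff_eq_sum_rankOne.1 (hM.1 k)
    have hq : ∀ v, quadForm (M k) v = ∑ l, ‖inner ℂ v (u l)‖ ^ 2 := by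
      intro v
      rw [hu, quadForm_sum]
      simp_rw [quadForm_rankOne]
    simp_rw [hq]
    refine (negEntropy_sum_le Finset.univ
      (fun l j => ‖inner ℂ (edge e r0 r1 j) (u l)‖ ^ 2) fun _ _ => sq_nonneg _).trans ?_
    refine (Finset.sum_le_sum fun l _ => hle (u l)).trans (le_of_eq ?_)
    rw [Finset.sum_add_distrib, ← Finset.mul_sum, ← Finset.mul_sum, Finset.sum_comm]
  have h2 := Finset.sum_le_sum fun k (_ : k ∈ Finset.univ) => hk k
  rw [sum_majorant e hm h0 h1 hs hM] at h2
  have h3 : 1 / (m * log 2) * ∑ k, negEntropy (fun j => quadForm (M k) (edge e r0 r1 j)) ≤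
      1 / (m * log 2) * (m * (c + μ * (m * r0))) :=
    mul_le_mul_of_nonneg_left h2 (by positivity)
  have h4 : 1 / (m * log 2) * (m * (c + μ * (m * r0))) = (c + μ * (m * r0)) / log 2 := by
    field_simp
  linarith

/-- Components of weight zero are exempt from touching; the M_rs at t = 1 rely on this. -/
lemma mutualInfo_eq_of_touch (e : OrthonormalBasis (Fin m) ℂ H) {r0 r1 : ℝ} (hm : 2 ≤ m)
    (h0 : 0 ≤ r0) (h1 : 0 ≤ r1) (hs : r0 + (m - 1) * r1 = 1) {M : κ → H →L[ℂ] H}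
    (hM : IsObservable M) {c μ : ℝ}
    (heq : ∀ k, ∃ (a : ℝ) (v : H), M k = (a : ℂ) • InnerProductSpace.rankOne ℂ v v ∧
      (a ≠ 0 → negEntropy (fun j => ‖inner ℂ (edge e r0 r1 j) v‖ ^ 2) =
        c * ∑ j, ‖inner ℂ (edge e r0 r1 j) v‖ ^ 2 +
          μ * ‖inner ℂ (∑ j, edge e r0 r1 j) v‖ ^ 2)) :
    mutualInfo (pyramidEnsemble e r0 r1 hm h0 h1 hs) M =
      logb 2 m + (c + μ * (m * r0)) / log 2 := by
  have hm0 : (0 : ℝ) < m := by exact_mod_cast (by omega : 0 < m)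
  have hl2 := Real.log_pos one_lt_two
  rw [mutualInfo_pyramid e hm h0 h1 hs hM]
  have hk : ∀ k, negEntropy (fun j => quadForm (M k) (edge e r0 r1 j)) =
      c * ∑ j, quadForm (M k) (edge e r0 r1 j) + μ * quadForm (M k) (∑ j, edge e r0 r1 j) := by
    intro k
    obtain ⟨a, v, hMk, hv⟩ := heq k
    simp_rw [hMk, quadForm_smul, quadForm_rankOne]
    by_cases ha : a = 0
    · simp [ha, negEntropy]
    · rw [negEntropy_smul _ ha, hv ha, ← Finset.mul_sum]
      ring
  rw [Finset.sum_congr rfl fun k _ => hk k, sum_majorant e hm h0 h1 hs hM]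
  congr 1
  field_simp

/-- The bound on the information which the majorant with parameter `β` gives. -/
def infoBound (m : ℕ) (r0 β : ℝ) : ℝ :=
  logb 2 m + (constCoef (m - 1) β + sumCoef (m - 1) β * (m * r0)) / log 2

theorem mutualInfo_le_infoBound (e : OrthonormalBasis (Fin m) ℂ H) {r0 r1 : ℝ} (hm : 2 ≤ m)
    (h0 : 0 ≤ r0) (h1 : 0 ≤ r1) (hs : r0 + (m - 1) * r1 = 1) {M : κ → H →L[ℂ] H}
    (hM : IsObservable M) {β : ℝ} (hβ0 : 0 ≤ β) (hβ1 : (m - 1) * β ≤ 1)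
    (hcoef : -log 2 ≤ constCoef (m - 1) β) (hflat : (m - 1) * β = 1 → r0 = 0) :
    mutualInfo (pyramidEnsemble e r0 r1 hm h0 h1 hs) M ≤ infoBound m r0 β := by
  have hm2 : (2 : ℝ) ≤ m := by exact_mod_cast hm
  refine mutualInfo_le_of_majorant e hm h0 h1 hs hM fun v => ?_
  rw [sum_inner]
  refine negEntropy_le_of_mem_Icc (by simp) (by linarith) hβ0 hβ1 hcoef
    (fun j => inner ℂ (edge e r0 r1 j) v) fun h => ?_
  rw [← sum_inner, sum_edge e hm, hflat h]
  simp

end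

end QPyramid

end

noncomputable section

namespace QPyramid

open Real

section
variable {m : ℕ} {H : Type*} [NormedAddCommGroup H] [InnerProductSpace ℂ H]

/-! ### Amplitudes of the edges -/

lemma inner_axis_basis (e : OrthonormalBasis (Fin m) ℂ H) (j : Fin m) :
    inner ℂ (axis e) (e j) = ((1 / √(m : ℝ) : ℝ) : ℂ) := by
  rw [← inner_conj_symm, inner_basis_axis, Complex.conj_ofReal]

lemma inner_edge_basis (e : OrthonormalBasis (Fin m) ℂ H) (r0 r1 : ℝ) (j k : Fin m) :
    inner ℂ (edge e r0 r1 j) (e k) =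
      ((√(m * r1) * (if j = k then 1 else 0) + (√r0 - √r1) / √(m : ℝ) : ℝ) : ℂ) := by
  unfold edge
  rw [inner_add_left, inner_smul_left, inner_smul_left, Complex.conj_ofReal, Complex.conj_ofReal,
    inner_axis_basis, e.inner_eq_ite]
  push_cast
  split_ifs <;> simp [div_eq_mul_inv]

lemma inner_edge_axis (e : OrthonormalBasis (Fin m) ℂ H) (hm : 2 ≤ m) (r0 r1 : ℝ) (j : Fin m) :
    inner ℂ (edge e r0 r1 j) (axis e) = ((√r0 : ℝ) : ℂ) := by
  have h0 : (0 : ℝ) < m := by exact_mod_cast (by omega : 0 < m)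
  unfold edge
  rw [inner_add_left, inner_smul_left, inner_smul_left, Complex.conj_ofReal, Complex.conj_ofReal,
    inner_basis_axis, inner_axis_axis e hm, mul_one, ← Complex.ofReal_mul, ← Complex.ofReal_add]
  congr 1
  have : √(m : ℝ) ≠ 0 := (Real.sqrt_pos.2 h0).ne'
  rw [Real.sqrt_mul h0.le]
  field_simp
  ring

/-- Stretching the axis by t replaces the ratio √r0/√r1 by τ, so t tunes the β at which the
amplitudes lie. -/
lemma inner_edge_etilde (e : OrthonormalBasis (Fin m) ℂ H) (hm : 2 ≤ m) {r0 r1 t τ : ℝ}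
    (ht : t * √r0 = τ * √r1) (hτ : 0 < (m : ℝ) - 1 + τ) (j k : Fin m) :
    inner ℂ (edge e r0 r1 j) (etilde e t k) =
      ((√r1 / √(m : ℝ) * (m - 1 + τ) * (if j = k then 1 else -((1 - τ) / (m - 1 + τ))) : ℝ) : ℂ) := by
  have h0 : (0 : ℝ) < m := by exact_mod_cast (by omega : 0 < m)
  have h1 : √(m : ℝ) ≠ 0 := (Real.sqrt_pos.2 h0).ne'
  have h2 : √(m : ℝ) ^ 2 = m := Real.sq_sqrt h0.le
  unfold etilde
  rw [inner_add_right, inner_smul_right, inner_edge_basis, inner_edge_axis e hm,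
    ← Complex.ofReal_mul, ← Complex.ofReal_add, Real.sqrt_mul h0.le]
  congr 1
  split_ifs
  · field_simp
    rw [h2]
    linear_combination ht
  · field_simp
    linear_combination ht

lemma inner_edge_diffVec (e : OrthonormalBasis (Fin m) ℂ H) (r0 r1 : ℝ) (j r s : Fin m) :
    inner ℂ (edge e r0 r1 j) (diffVec e r s) =
      ((√(m * r1) / √2 * ((if j = r then 1 else 0) - (if j = s then 1 else 0)) : ℝ) : ℂ) := by
  unfold diffVec
  rw [inner_smul_right, inner_sub_right, inner_edge_basis, inner_edge_basis,
    ← Complex.ofReal_sub, ← Complex.ofReal_mul]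
  congr 1
  ring

lemma touch_etilde (e : OrthonormalBasis (Fin m) ℂ H) (hm : 2 ≤ m) {r0 r1 t τ : ℝ}
    (hr1 : 0 < r1) (ht : t * √r0 = τ * √r1) (hτ0 : 0 ≤ τ) (hτ1 : τ ≤ 1) (k : Fin m) :
    negEntropy (fun j => ‖inner ℂ (edge e r0 r1 j) (etilde e t k)‖ ^ 2) =
      constCoef (m - 1) ((1 - τ) / (m - 1 + τ)) *
        ∑ j, ‖inner ℂ (edge e r0 r1 j) (etilde e t k)‖ ^ 2 +
      sumCoef (m - 1) ((1 - τ) / (m - 1 + τ)) *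
        ‖inner ℂ (∑ j, edge e r0 r1 j) (etilde e t k)‖ ^ 2 := by
  have hm2 : (2 : ℝ) ≤ m := by exact_mod_cast hm
  have hpos : 0 < (m : ℝ) - 1 + τ := by linarith
  set β := (1 - τ) / (m - 1 + τ) with hβ
  have hβ0 : 0 ≤ β := div_nonneg (by linarith) hpos.le
  set κ := √r1 / √(m : ℝ) * (m - 1 + τ) with hκ
  have hκ0 : 0 < κ := by positivity
  have hcard : (Fintype.card (Fin m) : ℝ) = ((m : ℝ) - 1) + 1 := by simp
  have hy : ∀ j, inner ℂ (edge e r0 r1 j) (etilde e t k) =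
      ((κ * (if j = k then 1 else -β) : ℝ) : ℂ) := fun j => inner_edge_etilde e hm ht hpos j k
  have hsq : ∀ j, ‖inner ℂ (edge e r0 r1 j) (etilde e t k)‖ ^ 2 =
      κ ^ 2 * (if j = k then 1 else β ^ 2) := by
    intro j
    rw [hy, Complex.norm_real, Real.norm_eq_abs, sq_abs, mul_pow]
    split_ifs <;> simp
  have hsum : ‖inner ℂ (∑ j, edge e r0 r1 j) (etilde e t k)‖ ^ 2 =
      κ ^ 2 * (1 - (m - 1) * β) ^ 2 := by
    rw [sum_inner]
    simp_rw [hy]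
    rw [← Complex.ofReal_sum, Complex.norm_real, Real.norm_eq_abs, sq_abs, ← Finset.mul_sum,
      sum_ite_const hcard]
    ring
  simp_rw [hsq]
  rw [negEntropy_smul _ (by positivity), negEntropy_touch hcard hβ0, hsum, ← Finset.mul_sum,
    sum_ite_const hcard]
  ring

/-- The amplitudes are two opposite numbers and zeros: their sum vanishes, so μ is arbitrary, and
the entropy is that of a fair coin. -/
lemma touch_diffVec (e : OrthonormalBasis (Fin m) ℂ H) (hm : 2 ≤ m) {r0 r1 : ℝ} (hr1 : 0 < r1)
    (μ : ℝ) {r s : Fin m} (hrs : r ≠ s) :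
    negEntropy (fun j => ‖inner ℂ (edge e r0 r1 j) (diffVec e r s)‖ ^ 2) =
      -log 2 * ∑ j, ‖inner ℂ (edge e r0 r1 j) (diffVec e r s)‖ ^ 2 +
        μ * ‖inner ℂ (∑ j, edge e r0 r1 j) (diffVec e r s)‖ ^ 2 := by
  have h0 : (0 : ℝ) < m := by exact_mod_cast (by omega : 0 < m)
  set κ := √(m * r1) / √2 with hκ
  have hκ0 : 0 < κ := by positivity
  have hsq : ∀ j, ‖inner ℂ (edge e r0 r1 j) (diffVec e r s)‖ ^ 2 =
      κ ^ 2 * ((if j = r then 1 else 0) + (if j = s then 1 else 0)) := by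
    intro j
    rw [inner_edge_diffVec, Complex.norm_real, Real.norm_eq_abs, sq_abs, mul_pow]
    congr 1
    by_cases h1 : j = r
    · have h2 : j ≠ s := h1 ▸ hrs
      simp [h1, hrs]
    · by_cases h2 : j = s <;> simp [h1, h2, hrs.symm]
  have hsum : inner ℂ (∑ j, edge e r0 r1 j) (diffVec e r s) = 0 := by
    rw [sum_inner]
    simp_rw [inner_edge_diffVec]
    rw [← Complex.ofReal_sum, ← Finset.mul_sum, Finset.sum_sub_distrib]
    simp
  simp_rw [hsq]
  rw [negEntropy_smul _ (by positivity), hsum, ← Finset.mul_sum]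
  have hlog : ∀ j : Fin m, ((if j = r then (1 : ℝ) else 0) + (if j = s then 1 else 0)) *
      log ((if j = r then 1 else 0) + (if j = s then 1 else 0)) = 0 := by
    intro j
    by_cases h1 : j = r
    · simp [h1, hrs]
    · by_cases h2 : j = s <;> simp [h1, h2, hrs.symm]
  unfold negEntropy
  simp_rw [hlog]
  rw [Finset.sum_add_distrib]
  simp
  norm_num
  ring

/-! ### Resolutions of the identity -/

/-- With P the projector on the axis, ẽ_k is the image of e_k under I + (t - 1)P, whose square is I
+ (t² - 1)P. -/
lemma sum_rankOne_etilde (e : OrthonormalBasis (Fin m) ℂ H) (hm : 2 ≤ m) (t : ℝ) :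
    ∑ k, InnerProductSpace.rankOne ℂ (etilde e t k) (etilde e t k) =
      ContinuousLinearMap.id ℂ H +
        ((t ^ 2 - 1 : ℝ) : ℂ) • InnerProductSpace.rankOne ℂ (axis e) (axis e) := by
  have h0 : (0 : ℝ) < m := by exact_mod_cast (by omega : 0 < m)
  have h1 : √(m : ℝ) ≠ 0 := (Real.sqrt_pos.2 h0).ne'
  have h2 : √(m : ℝ) ^ 2 = m := Real.sq_sqrt h0.le
  ext v
  set A := inner ℂ (axis e) v with hA
  set q : ℂ := ((√(m : ℝ) : ℝ) : ℂ) with hq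
  set s : ℝ := (t - 1) / √(m : ℝ) with hs
  have hsumA : ∑ k, inner ℂ (e k) v = q * A := by
    rw [← sum_inner, sum_basis_eq e hm, inner_smul_left, Complex.conj_ofReal]
  have hterm : ∀ k, InnerProductSpace.rankOne ℂ (etilde e t k) (etilde e t k) v =
      inner ℂ (e k) v • e k + (s * A) • e k + (s * inner ℂ (e k) v) • axis e +
        (s * s * A) • axis e := by
    intro k
    rw [InnerProductSpace.rankOne_apply]
    unfold etilde
    rw [inner_add_left, inner_smul_left, Complex.conj_ofReal, ← hs, ← hA]
    module
  simp only [_root_.sum_apply, hterm, Finset.sum_add_distrib, ← Finset.smul_sum, ← Finset.sum_smul]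
  rw [e.sum_repr', ← Finset.mul_sum, hsumA, sum_basis_eq e hm]
  simp only [_root_.add_apply, ContinuousLinearMap.id_apply,
    _root_.smul_apply, InnerProductSpace.rankOne_apply, Finset.sum_const,
    Finset.card_univ, Fintype.card_fin]
  rw [← hA, ← hq, ← Nat.cast_smul_eq_nsmul ℂ, add_assoc, add_assoc]
  simp only [smul_smul, ← add_smul]
  congr 2
  have hqs : q * s = t - 1 := by
    rw [hq, hs, ← Complex.ofReal_mul, mul_div_cancel₀ _ h1]; simp
  have hqq : q * q = m := by
    rw [hq, ← Complex.ofReal_mul, ← sq, h2]; simp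
  push_cast
  rw [← hqq]
  linear_combination (2 * A + A * (q * s + (t - 1))) * hqs

lemma sum_lt_smul_eq {f : Fin m → Fin m → H} (hsymm : ∀ i j, f i j = f j i)
    (hdiag : ∀ i, f i i = 0) :
    (2 : ℂ) • ∑ q : {q : Fin m × Fin m // q.1 < q.2}, f q.1.1 q.1.2 = ∑ i, ∑ j, f i j := by
  have h1 : ∑ q : {q : Fin m × Fin m // q.1 < q.2}, f q.1.1 q.1.2 =
      ∑ i, ∑ j, if i < j then f i j else 0 := by
    rw [← Fintype.sum_prod_type' (f := fun i j => if i < j then f i j else 0),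
      ← Finset.sum_filter]
    exact (Finset.sum_subtype (Finset.univ.filter fun q : Fin m × Fin m => q.1 < q.2)
      (by simp) fun q => f q.1 q.2).symm
  have h2 : ∑ i, ∑ j, (if i < j then f i j else 0) = ∑ i, ∑ j, (if j < i then f i j else 0) := by
    rw [Finset.sum_comm]
    simp_rw [hsymm]
  rw [two_smul, h1]
  conv_lhs => arg 2; rw [h2]
  simp_rw [← Finset.sum_add_distrib]
  refine Finset.sum_congr rfl fun i _ => Finset.sum_congr rfl fun j _ => ?_
  rcases lt_trichotomy i j with h | h | h
  · simp [h, h.not_gt]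
  · simp [h, hdiag]
  · simp [h, h.not_gt]

/-- Half the Laplacian of the complete graph, which equals m off the axis and 0 on it. -/
lemma sum_rankOne_diffVec (e : OrthonormalBasis (Fin m) ℂ H) (hm : 2 ≤ m) :
    ∑ q : {q : Fin m × Fin m // q.1 < q.2},
      InnerProductSpace.rankOne ℂ (diffVec e q.1.1 q.1.2) (diffVec e q.1.1 q.1.2) =
      ((m / 2 : ℝ) : ℂ) • (ContinuousLinearMap.id ℂ H -
        InnerProductSpace.rankOne ℂ (axis e) (axis e)) := by
  have h0 : (0 : ℝ) < m := by exact_mod_cast (by omega : 0 < m)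
  have h2 : √(m : ℝ) ^ 2 = m := Real.sq_sqrt h0.le
  ext v
  set A := inner ℂ (axis e) v with hA
  set q : ℂ := ((√(m : ℝ) : ℝ) : ℂ) with hq
  have hqq : q * q = m := by
    rw [hq, ← Complex.ofReal_mul, ← sq, h2]; simp
  have hsumA : ∑ k, inner ℂ (e k) v = q * A := by
    rw [← sum_inner, sum_basis_eq e hm, inner_smul_left, Complex.conj_ofReal]
  have hhalf : ((1 / √2 : ℝ) : ℂ) * ((1 / √2 : ℝ) : ℂ) = 1 / 2 := by
    rw [← Complex.ofReal_mul, div_mul_div_comm, Real.mul_self_sqrt zero_le_two]; norm_num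
  have hterm : ∀ i j, InnerProductSpace.rankOne ℂ (diffVec e i j) (diffVec e i j) v =
      (1 / 2 : ℂ) • (inner ℂ (e i) v • e i - inner ℂ (e i) v • e j - inner ℂ (e j) v • e i
        + inner ℂ (e j) v • e j) := by
    intro i j
    rw [InnerProductSpace.rankOne_apply]
    unfold diffVec
    rw [inner_smul_left, Complex.conj_ofReal, inner_sub_left, smul_smul, mul_right_comm, hhalf]
    module
  have hmain := sum_lt_smul_eq
    (f := fun i j => InnerProductSpace.rankOne ℂ (diffVec e i j) (diffVec e i j) v)
    (fun i j => by simp only [hterm]; module) (fun i => by simp only [hterm]; module)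
  have htwo : (2 : ℂ) ≠ 0 := two_ne_zero
  simp only [_root_.sum_apply]
  refine smul_right_injective H htwo ?_
  refine hmain.trans ?_
  simp only [hterm, ← Finset.smul_sum, Finset.sum_add_distrib, Finset.sum_sub_distrib,
    ← Finset.sum_smul, Finset.sum_const, Finset.card_univ, Fintype.card_fin, e.sum_repr', hsumA]
  simp only [sum_basis_eq e hm,
    _root_.sub_apply, ContinuousLinearMap.id_apply,
    _root_.smul_apply, InnerProductSpace.rankOne_apply, ← hA, ← hq]
  rw [← Nat.cast_smul_eq_nsmul ℂ, ← hqq]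
  have hm' : ((m / 2 : ℝ) : ℂ) = q * q / 2 := by rw [hqq]; push_cast; rfl
  have hfirst : ∑ x, inner ℂ (e x) v • m • e x = (q * q) • v := by
    rw [hqq, Nat.cast_smul_eq_nsmul]
    conv_rhs => rw [← e.sum_repr' v, Finset.smul_sum]
    exact Finset.sum_congr rfl fun x _ => smul_comm _ _ _
  rw [hm', hfirst]
  module

lemma isPositive_ofReal_smul_rankOne {a : ℝ} (ha : 0 ≤ a) (v : H) :
    (((a : ℝ) : ℂ) • InnerProductSpace.rankOne ℂ v v).IsPositive :=
  (InnerProductSpace.isPositive_rankOne_self v).smul_of_nonneg (by exact_mod_cast ha)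

lemma isObservable_pyramidObservable (e : OrthonormalBasis (Fin m) ℂ H) (hm : 2 ≤ m) {t : ℝ}
    (ht : 1 ≤ t) : IsObservable (pyramidObservable e t) := by
  have h0 : (0 : ℝ) < m := by exact_mod_cast (by omega : 0 < m)
  have ht2 : 1 ≤ t ^ 2 := one_le_pow₀ ht
  have hti : (t ^ 2)⁻¹ ≤ 1 := inv_le_one_of_one_le₀ ht2
  constructor
  · rintro (k | q)
    · exact isPositive_ofReal_smul_rankOne (by positivity) _
    · exact isPositive_ofReal_smul_rankOne (mul_nonneg (by positivity) (by linarith)) _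
  · rw [Fintype.sum_sum_type]
    simp only [pyramidObservable]
    rw [← Finset.smul_sum, ← Finset.smul_sum, sum_rankOne_etilde e hm, sum_rankOne_diffVec e hm,
      smul_smul, ← Complex.ofReal_mul]
    have e1 : 2 / (m : ℝ) * (1 - (t ^ 2)⁻¹) * (m / 2) = 1 - (t ^ 2)⁻¹ := by field_simp
    have e2 : (t ^ 2)⁻¹ * (t ^ 2 - 1) = 1 - (t ^ 2)⁻¹ := by
      have : t ^ 2 ≠ 0 := by positivity
      field_simp
    rw [e1, smul_add, smul_smul, ← Complex.ofReal_mul, e2]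
    push_cast
    module

/-- The limit `t → ∞` of the observables `pyramidObservable e t`. -/
def flatObservable (e : OrthonormalBasis (Fin m) ℂ H) :
    Option {q : Fin m × Fin m // q.1 < q.2} → H →L[ℂ] H
  | none => ((1 : ℝ) : ℂ) • InnerProductSpace.rankOne ℂ (axis e) (axis e)
  | some q => ((2 / (m : ℝ) : ℝ) : ℂ) •
      InnerProductSpace.rankOne ℂ (diffVec e q.1.1 q.1.2) (diffVec e q.1.1 q.1.2)

lemma isObservable_flatObservable (e : OrthonormalBasis (Fin m) ℂ H) (hm : 2 ≤ m) :
    IsObservable (flatObservable e) := by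
  have h0 : (0 : ℝ) < m := by exact_mod_cast (by omega : 0 < m)
  constructor
  · rintro (_ | q)
    · exact isPositive_ofReal_smul_rankOne zero_le_one _
    · exact isPositive_ofReal_smul_rankOne (by positivity) _
  · rw [Fintype.sum_option]
    simp only [flatObservable]
    rw [← Finset.smul_sum, sum_rankOne_diffVec e hm, smul_smul, ← Complex.ofReal_mul]
    have e1 : 2 / (m : ℝ) * (m / 2) = 1 := by field_simp
    rw [e1]
    simp

lemma IsObservable.comp_equiv {κ κ' : Type*} [Fintype κ] [Fintype κ'] {M : κ → H →L[ℂ] H}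
    (hM : IsObservable M) (f : κ' ≃ κ) : IsObservable (M ∘ f) :=
  ⟨fun k => hM.1 (f k), by rw [← hM.2]; exact f.sum_comp M⟩

/-! ### Information of the extremal observables -/

variable [FiniteDimensional ℂ H]

lemma mutualInfo_pyramidObservable_one (e : OrthonormalBasis (Fin m) ℂ H) {r0 r1 τ : ℝ}
    (hm : 2 ≤ m) (h0 : 0 ≤ r0) (h1 : 0 < r1) (hs : r0 + (m - 1) * r1 = 1)
    (hτ0 : 0 ≤ τ) (hτ1 : τ ≤ 1) (hτ : √r0 = τ * √r1) :
    mutualInfo (pyramidEnsemble e r0 r1 hm h0 h1.le hs) (pyramidObservable e 1) =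
      infoBound m r0 ((1 - τ) / (m - 1 + τ)) := by
  refine mutualInfo_eq_of_touch e hm h0 h1.le hs
    (isObservable_pyramidObservable e hm le_rfl) ?_
  rintro (k | q)
  · exact ⟨_, _, rfl, fun _ => touch_etilde e hm h1 (by rw [one_mul, hτ]) hτ0 hτ1 k⟩
  · exact ⟨_, _, rfl, fun h => absurd (by simp) h⟩

lemma mutualInfo_pyramidObservable (e : OrthonormalBasis (Fin m) ℂ H) {r0 r1 t τ : ℝ}
    (hm : 2 ≤ m) (h0 : 0 ≤ r0) (h1 : 0 < r1) (hs : r0 + (m - 1) * r1 = 1)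
    (hτ0 : 0 ≤ τ) (hτ1 : τ ≤ 1) (ht : 1 ≤ t) (hτ : t * √r0 = τ * √r1)
    (hcoef : constCoef (m - 1) ((1 - τ) / (m - 1 + τ)) = -log 2) :
    mutualInfo (pyramidEnsemble e r0 r1 hm h0 h1.le hs) (pyramidObservable e t) =
      infoBound m r0 ((1 - τ) / (m - 1 + τ)) := by
  refine mutualInfo_eq_of_touch e hm h0 h1.le hs (isObservable_pyramidObservable e hm ht) ?_
  rintro (k | q)
  · exact ⟨_, _, rfl, fun _ => touch_etilde e hm h1 hτ hτ0 hτ1 k⟩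
  · refine ⟨_, _, rfl, fun _ => ?_⟩
    rw [hcoef]
    exact touch_diffVec e hm h1 _ q.2.ne

/-- For r0 = 0 every edge is orthogonal to the axis: that outcome never occurs and only the pair
projectors contribute. -/
lemma mutualInfo_flatObservable (e : OrthonormalBasis (Fin m) ℂ H) {r1 : ℝ}
    (hm : 2 ≤ m) (h1 : 0 < r1) (hs : 0 + (m - 1) * r1 = 1) :
    mutualInfo (pyramidEnsemble e 0 r1 hm le_rfl h1.le hs) (flatObservable e) =
      logb 2 m + (-log 2 + 0 * (m * 0)) / log 2 := by
  refine mutualInfo_eq_of_touch e hm le_rfl h1.le hs (isObservable_flatObservable e hm) ?_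
  rintro (_ | q)
  · refine ⟨_, _, rfl, fun _ => ?_⟩
    simp [inner_edge_axis e hm, negEntropy]
  · exact ⟨_, _, rfl, fun _ => touch_diffVec e hm h1 _ q.2.ne⟩

/-! ### Accessible information from an extremal observable -/

lemma mutualInfo_comp_equiv {ι κ κ' : Type*} [Fintype ι] [Fintype κ] [Fintype κ']
    (E : Ensemble ι H) (M : κ → H →L[ℂ] H) (f : κ' ≃ κ) :
    mutualInfo E (M ∘ f) = mutualInfo E M := by
  unfold mutualInfo
  refine Finset.sum_congr rfl fun j _ => ?_
  exact f.sum_comp fun k => jointProb E M j k *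
    Real.logb 2 (jointProb E M j k / (E.prob j * outcomeProb E M k))

lemma accessibleInfo_eq {ι κ : Type*} [Fintype ι] [Fintype κ] {E : Ensemble ι H}
    {M : κ → H →L[ℂ] H} (hM : IsInfoOptimal E M) : accessibleInfo E = mutualInfo E M := by
  have hgreatest : IsGreatest (infoValues E) (mutualInfo E M) := by
    refine ⟨⟨Fintype.card κ, M ∘ (Fintype.equivFin κ).symm, hM.1.comp_equiv _,
      (mutualInfo_comp_equiv E M _).symm⟩, ?_⟩
    rintro _ ⟨n, N, hN, rfl⟩
    exact hM.2 n N hN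
  exact hgreatest.csSup_eq

end

end QPyramid

end

noncomputable section

namespace QPyramid

open Real

/-! ### The numerical parameters -/

/-- The ratio `β = -b / a` of the coefficients of the pyramid with `√r₀ = τ √r₁`. -/
def edgeRatio (m : ℕ) (τ : ℝ) : ℝ := (1 - τ) / (m - 1 + τ)

section
variable {m : ℕ} {τ τ' : ℝ}

lemma one_add_edgeRatio (h : 0 < (m : ℝ) - 1 + τ) :
    1 + edgeRatio m τ = m / (m - 1 + τ) := by
  unfold edgeRatio; field_simp; ring

lemma one_sub_mul_edgeRatio (h : 0 < (m : ℝ) - 1 + τ) :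
    1 - (m - 1) * edgeRatio m τ = m * τ / (m - 1 + τ) := by
  unfold edgeRatio; field_simp; ring

lemma one_add_mul_edgeRatio_sq (h : 0 < (m : ℝ) - 1 + τ) :
    1 + (m - 1) * edgeRatio m τ ^ 2 = m * (m - 1 + τ ^ 2) / (m - 1 + τ) ^ 2 := by
  unfold edgeRatio; field_simp; ring

lemma edgeRatio_nonneg (h : 0 < (m : ℝ) - 1 + τ) (h1 : τ ≤ 1) : 0 ≤ edgeRatio m τ :=
  div_nonneg (by linarith) h.le

lemma edgeRatio_pos (h : 0 < (m : ℝ) - 1 + τ) (h1 : τ < 1) : 0 < edgeRatio m τ :=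
  div_pos (by linarith) h

lemma mul_edgeRatio_le_one (hm : 2 ≤ m) (h : 0 ≤ τ) : (m - 1) * edgeRatio m τ ≤ 1 := by
  have hm2 : (2 : ℝ) ≤ m := by exact_mod_cast hm
  have hp : 0 < (m : ℝ) - 1 + τ := by linarith
  have := one_sub_mul_edgeRatio hp
  have h2 : 0 ≤ m * τ / ((m : ℝ) - 1 + τ) := by positivity
  linarith

lemma edgeRatio_lt_iff (hm : 2 ≤ m) (h : 0 < (m : ℝ) - 1 + τ) (h' : 0 < (m : ℝ) - 1 + τ') :
    edgeRatio m τ < edgeRatio m τ' ↔ τ' < τ := by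
  have hm2 : (2 : ℝ) ≤ m := by exact_mod_cast hm
  unfold edgeRatio
  rw [div_lt_div_iff₀ h h']
  constructor <;> intro hlt <;> nlinarith

lemma edgeRatio_le_iff (hm : 2 ≤ m) (h : 0 < (m : ℝ) - 1 + τ) (h' : 0 < (m : ℝ) - 1 + τ') :
    edgeRatio m τ ≤ edgeRatio m τ' ↔ τ' ≤ τ :=
  le_iff_le_iff_lt_iff_lt.2 (edgeRatio_lt_iff hm h' h)

lemma log_edgeRatio (h : 0 < (m : ℝ) - 1 + τ) (h1 : τ < 1) :
    log (edgeRatio m τ) = log (1 - τ) - log (m - 1 + τ) := by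
  unfold edgeRatio
  rw [Real.log_div (by linarith) h.ne']

/-- The origin of `gObt`: the majorant is admissible exactly when `gObt m τ ≤ 0`, and a zero of
`gObt` is the level -log 2. -/
lemma constCoef_edgeRatio (hm : 2 ≤ m) (h : 0 < (m : ℝ) - 1 + τ) (h1 : τ ≤ 1) :
    constCoef (m - 1) (edgeRatio m τ) = -(gObt m τ + 1) * log 2 := by
  have hm2 : (2 : ℝ) ≤ m := by exact_mod_cast hm
  have hl2 := (Real.log_pos one_lt_two).ne'
  have hm0 : (m : ℝ) ≠ 0 := by positivity
  have hq : 0 < (m : ℝ) - 1 + τ ^ 2 := by nlinarith [sq_nonneg τ]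
  have hlog : edgeRatio m τ * log (edgeRatio m τ) =
      edgeRatio m τ * (log (1 - τ) - log (m - 1 + τ)) := by
    rcases h1.eq_or_lt with h1 | h1
    · simp [edgeRatio, h1]
    · rw [log_edgeRatio h h1]
  unfold constCoef
  rw [one_add_mul_edgeRatio_sq h, one_add_edgeRatio h, hlog, Real.log_div (by positivity)
    (by positivity), Real.log_mul hm0 hq.ne', Real.log_pow]
  unfold gObt Real.logb edgeRatio
  rw [Real.log_div (by positivity) two_ne_zero, Real.log_mul hm0 hq.ne', Real.log_pow,
    Real.log_pow]
  field_simp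
  push_cast
  ring

lemma gObt_strictAntiOn (hm : 2 ≤ m) : StrictAntiOn (gObt m) (Set.Icc 0 1) := by
  have hm2 : (2 : ℝ) ≤ m := by exact_mod_cast hm
  intro τ hτ τ' hτ' hlt
  have hp : 0 < (m : ℝ) - 1 + τ := by linarith [hτ.1]
  have hp' : 0 < (m : ℝ) - 1 + τ' := by linarith [hτ'.1]
  have hmem : ∀ t ∈ Set.Icc (0 : ℝ) 1, edgeRatio m t ∈ Set.Icc 0 (1 / ((m : ℝ) - 1)) := by
    intro t ht
    refine ⟨edgeRatio_nonneg (by linarith [ht.1]) ht.2, ?_⟩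
    rw [le_div_iff₀ (by linarith), mul_comm]
    exact mul_edgeRatio_le_one hm ht.1
  have := constCoef_strictAntiOn (n := (m : ℝ) - 1) (by linarith) (hmem τ' hτ') (hmem τ hτ)
    ((edgeRatio_lt_iff hm hp' hp).2 hlt)
  rw [constCoef_edgeRatio hm hp hτ.2, constCoef_edgeRatio hm hp' hτ'.2] at this
  have hl2 := Real.log_pos one_lt_two
  nlinarith

lemma continuous_gObt (hm : 2 ≤ m) : Continuous (gObt m) := by
  have hm2 : (2 : ℝ) ≤ m := by exact_mod_cast hm
  have hx : Continuous fun x : ℝ => x / m * logb 2 (x ^ 2) := by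
    have : (fun x : ℝ => x / m * logb 2 (x ^ 2)) = fun x => 2 / (m * log 2) * (x * log x) := by
      funext x
      rw [Real.logb, Real.log_pow]
      push_cast
      field_simp
    rw [this]
    exact Real.continuous_mul_log.const_mul _
  have hq : ∀ x : ℝ, (m : ℝ) * (m - 1 + x ^ 2) / 2 ≠ 0 := fun x => by
    have : 0 < (m : ℝ) - 1 + x ^ 2 := by nlinarith [sq_nonneg x]
    positivity
  unfold gObt Real.logb at *
  refine ((Continuous.div_const (Continuous.log (by fun_prop) hq) _).sub
    (hx.comp (by fun_prop : Continuous fun τ : ℝ => (m : ℝ) - 1 + τ))).sub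
    (hx.comp (by fun_prop : Continuous fun τ : ℝ => 1 - τ))

lemma gObt_one (hm : 2 ≤ m) : gObt m 1 = -1 := by
  have hm2 : (2 : ℝ) ≤ m := by exact_mod_cast hm
  have h := constCoef_edgeRatio (τ := 1) hm (by linarith) le_rfl
  have hl2 := (Real.log_pos one_lt_two).ne'
  have : edgeRatio m 1 = 0 := by simp [edgeRatio]
  rw [this] at h
  simp [constCoef, hl2] at h
  linarith

lemma gObt_zero_mul (hm : 2 ≤ m) :
    gObt m 0 * (m * log 2) =
      m * log m - (m * log 2 + ((m : ℝ) - 2) * log (m - 1)) := by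
  have hm2 : (2 : ℝ) ≤ m := by exact_mod_cast hm
  have hl2 := (Real.log_pos one_lt_two).ne'
  have h1 : 0 < (m : ℝ) - 1 := by linarith
  unfold gObt Real.logb
  rw [Real.log_div (by positivity) two_ne_zero]
  simp only [ne_eq, OfNat.ofNat_ne_zero, not_false_eq_true, zero_pow, add_zero, sub_zero,
    one_pow, Real.log_one, zero_div, mul_zero]
  rw [Real.log_mul (by positivity) h1.ne', Real.log_pow]
  field_simp
  push_cast
  ring

-- Existence and sign of the greatest zero

lemma gObt_zero_nonneg (hm : 2 ≤ m) (hm6 : m ≤ 6) : 0 ≤ gObt m 0 := by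
  have hm2 : (2 : ℝ) ≤ m := by exact_mod_cast hm
  have hl2 := Real.log_pos one_lt_two
  have hmul := gObt_zero_mul hm
  have hn : 0 < (m : ℝ) - 1 := by linarith
  -- The sign of `gObt m 0` is that of the logarithm of the quotient of these two powers; they are
  -- equal for m = 2.
  have hpow : (2 : ℝ) ^ m * ((m : ℝ) - 1) ^ (m - 2) ≤ (m : ℝ) ^ m := by
    interval_cases m <;> norm_num
  have hlog := Real.log_le_log (by positivity) hpow
  rw [Real.log_mul (by positivity) (by positivity), Real.log_pow, Real.log_pow, Real.log_pow,
    Nat.cast_sub hm] at hlog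
  push_cast at hlog
  have h0 : 0 ≤ gObt m 0 * (m * log 2) := by rw [hmul]; linarith
  exact nonneg_of_mul_nonneg_left h0 (by positivity)

/-- The induction step is multiplied by (k + 1)^k so that the hypothesis applies; what remains
follows from (k + 1)(k + 3) ≤ (k + 2)² and (k + 3)³ ≤ 2 (k + 2)³. -/
lemma succ_pow_lt {n : ℕ} (hn : 6 ≤ n) : (n + 1) ^ (n + 1) < 2 ^ (n + 1) * n ^ (n - 1) := by
  induction n, hn using Nat.le_induction with
  | base => norm_num
  | succ n hn ih =>
    obtain ⟨k, rfl⟩ : ∃ k, n = k + 1 := ⟨n - 1, by omega⟩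
    simp only [Nat.add_sub_cancel] at ih ⊢
    have h1 : ((k + 1) * (k + 3)) ^ k ≤ ((k + 2) ^ 2) ^ k := Nat.pow_le_pow_left (by nlinarith) k
    have h2 : (k + 3) ^ 3 ≤ 2 * (k + 2) ^ 3 := by nlinarith [sq_nonneg k]
    have h3 : (k + 3) ^ (k + 3) * (k + 1) ^ k ≤ 2 * (k + 2) ^ (k + 1) * (k + 2) ^ (k + 2) := by
      calc (k + 3) ^ (k + 3) * (k + 1) ^ k = (k + 3) ^ 3 * ((k + 1) * (k + 3)) ^ k := by
            rw [mul_pow]; ring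
        _ ≤ (2 * (k + 2) ^ 3) * ((k + 2) ^ 2) ^ k := Nat.mul_le_mul h2 h1
        _ = 2 * (k + 2) ^ (k + 1) * (k + 2) ^ (k + 2) := by rw [← pow_mul]; ring
    have hpos : 0 < (k + 1) ^ k := by positivity
    refine lt_of_mul_lt_mul_right (a := (k + 1) ^ k) ?_ (Nat.zero_le _)
    calc (k + 1 + 1 + 1) ^ (k + 1 + 1 + 1) * (k + 1) ^ k
        ≤ 2 * (k + 2) ^ (k + 1) * (k + 2) ^ (k + 2) := h3
      _ < 2 * (k + 2) ^ (k + 1) * (2 ^ (k + 2) * (k + 1) ^ k) :=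
          Nat.mul_lt_mul_of_pos_left ih (by positivity)
      _ = _ := by ring

lemma gObt_zero_neg (hm : 7 ≤ m) : gObt m 0 < 0 := by
  have hm2 : (7 : ℝ) ≤ m := by exact_mod_cast hm
  have hl2 := Real.log_pos one_lt_two
  have hmul := gObt_zero_mul (m := m) (by omega)
  have hn : 0 < (m : ℝ) - 1 := by linarith
  have hpow : (m : ℝ) ^ m < (2 : ℝ) ^ m * ((m : ℝ) - 1) ^ (m - 2) := by
    obtain ⟨n, rfl⟩ : ∃ n, m = n + 1 := ⟨m - 1, by omega⟩
    have h := succ_pow_lt (n := n) (by omega)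
    have e : (((n + 1 : ℕ) : ℝ) - 1) = n := by push_cast; ring
    rw [e, show n + 1 - 2 = n - 1 by omega]
    exact_mod_cast h
  have hlog := Real.log_lt_log (by positivity) hpow
  rw [Real.log_mul (by positivity) (by positivity), Real.log_pow, Real.log_pow, Real.log_pow,
    Nat.cast_sub (by omega)] at hlog
  push_cast at hlog
  have h0 : gObt m 0 * (m * log 2) < 0 := by rw [hmul]; linarith
  exact neg_of_mul_neg_left h0 (by positivity)

lemma gObt_one_sub_pos (hm : 7 ≤ m) : 0 < gObt m (1 - m) := by
  have hm2 : (7 : ℝ) ≤ m := by exact_mod_cast hm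
  have hl2 := Real.log_pos one_lt_two
  have hn : 0 < (m : ℝ) - 1 := by linarith
  have e : gObt m (1 - m) = logb 2 (((m : ℝ) - 1) / 2) := by
    unfold gObt
    have e1 : (m : ℝ) * (m - 1 + (1 - m) ^ 2) / 2 = (m : ℝ) ^ 2 * ((m - 1) / 2) := by ring
    have e2 : (1 - (1 - (m : ℝ))) = m := by ring
    rw [e1, e2, Real.logb_mul (by positivity) (by positivity)]
    have : (m : ℝ) ≠ 0 := by positivity
    field_simp
    simp
    ring
  rw [e]
  exact Real.logb_pos one_lt_two (by linarith)

/-- The zero of `gObt m` in `[0, 1]` for `m ≤ 6`. -/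
lemma exists_zero_of_le_six (hm : 2 ≤ m) (hm6 : m ≤ 6) :
    ∃ τ ∈ Set.Icc (0 : ℝ) 1, gObt m τ = 0 := by
  have h := intermediate_value_Icc' (zero_le_one' ℝ) (continuous_gObt hm).continuousOn
  exact h ⟨by rw [gObt_one hm]; norm_num, gObt_zero_nonneg hm hm6⟩

lemma exists_zero_of_seven_le (hm : 7 ≤ m) :
    ∃ τ ∈ Set.Icc (1 - (m : ℝ)) 0, gObt m τ = 0 := by
  have hm2 : (7 : ℝ) ≤ m := by exact_mod_cast hm
  have h := intermediate_value_Icc' (a := 1 - (m : ℝ)) (b := 0) (by linarith)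
    (continuous_gObt (m := m) (by omega)).continuousOn
  exact h ⟨(gObt_zero_neg hm).le, (gObt_one_sub_pos hm).le⟩

lemma isGreatest_tauObt (hm : 2 ≤ m) :
    IsGreatest {τ : ℝ | τ ≤ 1 ∧ gObt m τ = 0} (tauObt m) := by
  have hclosed : IsClosed {τ : ℝ | τ ≤ 1 ∧ gObt m τ = 0} :=
    isClosed_Iic.inter (isClosed_eq (continuous_gObt hm) continuous_const)
  have hbdd : BddAbove {τ : ℝ | τ ≤ 1 ∧ gObt m τ = 0} := ⟨1, fun _ h => h.1⟩
  have hne : {τ : ℝ | τ ≤ 1 ∧ gObt m τ = 0}.Nonempty := by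
    rcases Nat.lt_or_ge 6 m with h | h
    · obtain ⟨τ, h1, h2⟩ := exists_zero_of_seven_le h
      exact ⟨τ, h1.2.trans zero_le_one, h2⟩
    · obtain ⟨τ, h1, h2⟩ := exists_zero_of_le_six hm h
      exact ⟨τ, h1.2, h2⟩
  exact ⟨hclosed.csSup_mem hne hbdd, fun τ h => le_csSup hbdd h⟩

lemma tauObt_lt_one (hm : 2 ≤ m) : tauObt m < 1 := by
  have h := (isGreatest_tauObt hm).1
  refine lt_of_le_of_ne h.1 fun h1 => ?_
  have := h.2
  rw [h1, gObt_one hm] at this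
  norm_num at this

lemma tauObt_nonneg (hm : 2 ≤ m) (hm6 : m ≤ 6) : 0 ≤ tauObt m := by
  obtain ⟨τ, h1, h2⟩ := exists_zero_of_le_six hm hm6
  exact h1.1.trans ((isGreatest_tauObt hm).2 ⟨h1.2, h2⟩)

lemma setOf_zero_eq_singleton (hm : 2 ≤ m) (hm6 : m ≤ 6) :
    {τ : ℝ | τ ∈ Set.Icc 0 1 ∧ gObt m τ = 0} = {tauObt m} := by
  have h := (isGreatest_tauObt hm).1
  have h0 := tauObt_nonneg hm hm6
  ext τ
  constructor
  · rintro ⟨h1, h2⟩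
    exact (gObt_strictAntiOn hm).injOn h1 ⟨h0, h.1⟩ (by rw [h2, h.2])
  · rintro rfl
    exact ⟨⟨h0, h.1⟩, h.2⟩

lemma tauObt_neg (hm : 7 ≤ m) : tauObt m < 0 := by
  have hm2 : 2 ≤ m := by omega
  have h := (isGreatest_tauObt hm2).1
  by_contra hge
  push Not at hge
  have h1 := (gObt_strictAntiOn hm2).antitoneOn ⟨le_rfl, zero_le_one⟩ ⟨hge, h.1⟩ hge
  rw [h.2] at h1
  exact (gObt_zero_neg hm).not_ge h1

/-- Keeps `edgeRatio m (tauObt m)` meaningful when the zero is negative: for m ≥ 7 there is a zero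
strictly above 1 - m. -/
lemma tauObt_gt (hm : 2 ≤ m) : 0 < (m : ℝ) - 1 + tauObt m := by
  have hm2 : (2 : ℝ) ≤ m := by exact_mod_cast hm
  rcases Nat.lt_or_ge 6 m with h | h
  · obtain ⟨τ, h1, h2⟩ := exists_zero_of_seven_le h
    have hle := (isGreatest_tauObt hm).2 ⟨h1.2.trans zero_le_one, h2⟩
    have hne : τ ≠ 1 - m := by
      rintro rfl
      exact (gObt_one_sub_pos h).ne' h2
    have := lt_of_le_of_ne h1.1 (Ne.symm hne)
    linarith
  · linarith [tauObt_nonneg hm h]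

/-- The same form as `coefA_sq`, so comparing p with p(m) amounts to comparing τ with τ_o. -/
lemma pObt_eq (hm : 2 ≤ m) : pObt m = (1 + (m - 1) * edgeRatio m (tauObt m) ^ 2)⁻¹ := by
  have h1 := tauObt_lt_one hm
  have h2 := tauObt_gt hm
  have h3 : 0 < 1 - tauObt m := by linarith
  unfold pObt edgeRatio
  have : (1 - (m : ℝ) / (1 - tauObt m)) = -((m - 1 + tauObt m) / (1 - tauObt m)) := by
    field_simp; ring
  rw [this, neg_sq, ← inv_pow, inv_div]

lemma inv_one_add_le_iff {n x y : ℝ} (hn : 0 < n) (hx : 0 ≤ x) (hy : 0 ≤ y) :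
    (1 + n * x ^ 2)⁻¹ ≤ (1 + n * y ^ 2)⁻¹ ↔ y ≤ x := by
  rw [inv_le_inv₀ (by positivity) (by positivity), add_le_add_iff_left,
    mul_le_mul_iff_right₀ hn]
  exact pow_le_pow_iff_left₀ hy hx two_ne_zero

lemma pObt_lt (hm : 7 ≤ m) : pObt m < ((m : ℝ) - 1) / m := by
  have hm2 : (7 : ℝ) ≤ m := by exact_mod_cast hm
  have h2 := tauObt_gt (m := m) (by omega)
  have h3 := one_sub_mul_edgeRatio h2
  have h4 : m * tauObt m / ((m : ℝ) - 1 + tauObt m) < 0 :=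
    div_neg_of_neg_of_pos (mul_neg_of_pos_of_neg (by linarith) (tauObt_neg hm)) h2
  have h5 : 1 < ((m : ℝ) - 1) * edgeRatio m (tauObt m) := by linarith
  have h6 : 0 < 1 + ((m : ℝ) - 1) * edgeRatio m (tauObt m) ^ 2 := by
    have : 0 < (m : ℝ) - 1 := by linarith
    positivity
  rw [pObt_eq (by omega), lt_div_iff₀ (by linarith), inv_mul_lt_iff₀ h6]
  nlinarith

end

/-! ### The coefficients of the pyramid -/

section
variable {m : ℕ} {r0 r1 τ : ℝ}

lemma coefB_eq (hr1 : 0 < r1) (hm : 2 ≤ m) (hτ0 : 0 ≤ τ) (hτ : √r0 = τ * √r1) :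
    coefB m r0 r1 = -(edgeRatio m τ * coefA m r0 r1) := by
  have hm2 : (2 : ℝ) ≤ m := by exact_mod_cast hm
  have hp : (m : ℝ) - 1 + τ ≠ 0 := by linarith
  have h0 : (0 : ℝ) < m := by linarith
  have h1 : √(m : ℝ) ≠ 0 := (Real.sqrt_pos.2 h0).ne'
  have h2 : √(m : ℝ) ^ 2 = m := Real.sq_sqrt h0.le
  unfold coefA coefB edgeRatio
  rw [hτ, Real.sqrt_mul h0.le]
  field_simp
  rw [h2]
  ring

lemma coefA_sq (hr1 : 0 < r1) (hm : 2 ≤ m) (hr0 : 0 ≤ r0) (hτ0 : 0 ≤ τ) (hτ : √r0 = τ * √r1)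
    (hs : r0 + (m - 1) * r1 = 1) :
    coefA m r0 r1 ^ 2 = (1 + (m - 1) * edgeRatio m τ ^ 2)⁻¹ := by
  have hm2 : (2 : ℝ) ≤ m := by exact_mod_cast hm
  have hp : 0 < (m : ℝ) - 1 + τ := by linarith
  have hq : 0 < (m : ℝ) - 1 + τ ^ 2 := by nlinarith [sq_nonneg τ]
  have h0 : (0 : ℝ) < m := by linarith
  have h1 : √(m : ℝ) ≠ 0 := (Real.sqrt_pos.2 h0).ne'
  have h2 : √(m : ℝ) ^ 2 = m := Real.sq_sqrt h0.le
  have h3 : √r1 ^ 2 = r1 := Real.sq_sqrt hr1.le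
  have h4 : r0 = τ ^ 2 * r1 := by
    rw [← Real.sq_sqrt hr0, hτ, mul_pow, h3]
  have h5 : coefA m r0 r1 = √r1 / √(m : ℝ) * (m - 1 + τ) := by
    unfold coefA
    rw [hτ, Real.sqrt_mul h0.le]
    field_simp
    rw [h2]
    ring
  rw [one_add_mul_edgeRatio_sq hp, h5, inv_div, mul_pow, div_pow, h2, h3]
  field_simp
  rw [h4] at hs
  linear_combination hs

lemma mul_r0_eq (hr1 : 0 < r1) (hm : 2 ≤ m) (hr0 : 0 ≤ r0) (hτ0 : 0 ≤ τ) (hτ : √r0 = τ * √r1)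
    (hs : r0 + (m - 1) * r1 = 1) :
    m * r0 = coefA m r0 r1 ^ 2 * (1 - (m - 1) * edgeRatio m τ) ^ 2 := by
  have hm2 : (2 : ℝ) ≤ m := by exact_mod_cast hm
  have hp : 0 < (m : ℝ) - 1 + τ := by linarith
  have hq : 0 < (m : ℝ) - 1 + τ ^ 2 := by nlinarith [sq_nonneg τ]
  have h3 : √r1 ^ 2 = r1 := Real.sq_sqrt hr1.le
  have h4 : r0 = τ ^ 2 * r1 := by
    rw [← Real.sq_sqrt hr0, hτ, mul_pow, h3]
  rw [coefA_sq hr1 hm hr0 hτ0 hτ hs, one_add_mul_edgeRatio_sq hp, one_sub_mul_edgeRatio hp]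
  field_simp
  rw [h4] at hs ⊢
  linear_combination τ ^ 2 * hs

lemma infoBound_eq_srmInfo (hr1 : 0 < r1) (hm : 2 ≤ m) (hr0 : 0 ≤ r0) (hτ0 : 0 ≤ τ)
    (hτ1 : τ ≤ 1) (hτ : √r0 = τ * √r1) (hs : r0 + (m - 1) * r1 = 1) :
    infoBound m r0 (edgeRatio m τ) = srmInfo m r0 r1 := by
  have hm2 : (2 : ℝ) ≤ m := by exact_mod_cast hm
  have hp : 0 < (m : ℝ) - 1 + τ := by linarith
  have hA := coefA_sq hr1 hm hr0 hτ0 hτ hs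
  have hR := mul_r0_eq hr1 hm hr0 hτ0 hτ hs
  have hB := coefB_eq hr1 hm hτ0 hτ
  have hβ0 := edgeRatio_nonneg hp hτ1
  set β := edgeRatio m τ with hβ
  have hn : 0 ≤ (m : ℝ) - 1 := by linarith
  have hN : 0 < 1 + ((m : ℝ) - 1) * β ^ 2 := by positivity
  have hid := constCoef_mul_add_sumCoef_mul (n := (m : ℝ) - 1) hβ0
  have hl2 := (Real.log_pos one_lt_two).ne'
  unfold infoBound srmInfo
  rw [hR, hB, neg_sq, mul_pow, hA]
  set N := 1 + ((m : ℝ) - 1) * β ^ 2 with hNdef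
  have hlogB : β ^ 2 * N⁻¹ * log (β ^ 2 * N⁻¹) = β ^ 2 * N⁻¹ * (2 * log β - log N) := by
    rcases hβ0.eq_or_lt with h | h
    · rw [← h]; simp
    · rw [Real.log_mul (by positivity) (by positivity), Real.log_pow, Real.log_inv]
      push_cast; ring
  have hexpand : constCoef (m - 1) β + sumCoef (m - 1) β * (N⁻¹ * (1 - (m - 1) * β) ^ 2) =
      N⁻¹ * ((m - 1) * (β ^ 2 * (2 * log β)) - N * log N) := by
    rw [← hid]
    field_simp
  rw [hexpand, add_assoc]
  congr 1
  simp only [Real.logb]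
  have e2 : ((m : ℝ) - 1) * (β ^ 2 * N⁻¹) * (log (β ^ 2 * N⁻¹) / log 2) =
      (m - 1) * (β ^ 2 * N⁻¹ * log (β ^ 2 * N⁻¹)) / log 2 := by ring
  rw [e2, hlogB, Real.log_inv]
  field_simp
  rw [hNdef]
  ring

-- Closed forms for nearly flat pyramids

lemma sumCoef_edgeRatio (hm : 2 ≤ m) (hτ0 : 0 < τ) (hτ1 : τ < 1) :
    sumCoef (m - 1) (edgeRatio m τ) =
      2 * (1 - τ) * (m - 1 + τ) * (log (m - 1 + τ) - log (1 - τ)) / (m ^ 2 * τ) := by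
  have hm2 : (2 : ℝ) ≤ m := by exact_mod_cast hm
  have hp : 0 < (m : ℝ) - 1 + τ := by linarith
  have h0 : (m : ℝ) ≠ 0 := by linarith
  unfold sumCoef
  rw [one_add_edgeRatio hp, one_sub_mul_edgeRatio hp, log_edgeRatio hp hτ1]
  unfold edgeRatio
  field_simp
  ring

lemma logb_of_gObt_eq_zero (hm : 2 ≤ m) (hτ1 : τ < 1) (hg : gObt m τ = 0) :
    logb 2 (2 * (τ - 1) ^ 2 / (m * (m - 1 + τ ^ 2))) =
      -(2 * (m - 1 + τ) / m * ((log (m - 1 + τ) - log (1 - τ)) / log 2)) := by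
  have hm2 : (2 : ℝ) ≤ m := by exact_mod_cast hm
  have h0 : (m : ℝ) ≠ 0 := by linarith
  have hq : 0 < (m : ℝ) - 1 + τ ^ 2 := by nlinarith [sq_nonneg τ]
  have hl2 := (Real.log_pos one_lt_two).ne'
  have h1 : (1 - τ) ≠ 0 := by linarith
  have e : 2 * (τ - 1) ^ 2 / (m * (m - 1 + τ ^ 2)) =
      (1 - τ) ^ 2 / (m * (m - 1 + τ ^ 2) / 2) := by field_simp; ring
  rw [e, Real.logb_div (by positivity) (by positivity)]
  unfold gObt at hg
  have h2 : logb 2 (m * (m - 1 + τ ^ 2) / 2) = (m - 1 + τ) / m * logb 2 ((m - 1 + τ) ^ 2)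
    + (1 - τ) / m * logb 2 ((1 - τ) ^ 2) := by linarith
  rw [h2]
  simp only [Real.logb, Real.log_pow]
  field_simp
  push_cast
  ring

/-- With p = 1/N one has (1 - p)/(m - 1) = β²/N, so every square root is rational in β and √N. -/
lemma muTilde0_eq {β : ℝ} (hm : 2 ≤ m) (hβ0 : 0 < β) (hβ1 : (m - 1) * β < 1) :
    muTilde0 m (1 + (m - 1) * β ^ 2)⁻¹ = -(sumCoef (m - 1) β / log 2) := by
  have hm2 : (2 : ℝ) ≤ m := by exact_mod_cast hm
  have hn : 0 < (m : ℝ) - 1 := by linarith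
  have hl2 := (Real.log_pos one_lt_two).ne'
  set N := 1 + ((m : ℝ) - 1) * β ^ 2 with hN
  have hN0 : 0 < N := by positivity
  have hsN : 0 < √N := Real.sqrt_pos.2 hN0
  have hNN : √N * √N = N := Real.mul_self_sqrt hN0.le
  have e1 : (1 - N⁻¹) / ((m : ℝ) - 1) = β ^ 2 / N := by
    field_simp
    rw [hN]; ring
  have e2 : N⁻¹ * (1 - N⁻¹) / ((m : ℝ) - 1) = (β / N) ^ 2 := by
    rw [mul_div_assoc, e1]; field_simp
  unfold muTilde0
  rw [e2, e1, Real.sqrt_sq (by positivity), Real.sqrt_div (by positivity), Real.sqrt_sq hβ0.le,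
    Real.sqrt_inv, Real.logb, Real.logb, Real.log_inv, Real.log_div (by positivity) hN0.ne',
    Real.log_pow]
  unfold sumCoef
  have h3 : 1 - ((m : ℝ) - 1) * β ≠ 0 := by linarith
  have e3 : (((m : ℝ) - 1) * (β / √N) - (√N)⁻¹) * ((√N)⁻¹ + β / √N) =
      -((1 - (m - 1) * β) * (1 + β)) / N := by
    have hinv : (√N)⁻¹ * (√N)⁻¹ = N⁻¹ := by rw [← mul_inv, hNN]
    simp only [div_eq_mul_inv]
    linear_combination ((((m : ℝ) - 1) * β - 1) * (1 + β)) * hinv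
  rw [e3]
  field_simp
  push_cast
  ring

end

end QPyramid

end

-- Optimality criteria in terms of τ, and the theorem

noncomputable section

namespace QPyramid

open Real

section
variable {m : ℕ} {H : Type*} [NormedAddCommGroup H] [InnerProductSpace ℂ H]
  [FiniteDimensional ℂ H] {r0 r1 τ : ℝ}

lemma mul_edgeRatio_lt_one (hm : 2 ≤ m) (h : 0 < τ) : (m - 1) * edgeRatio m τ < 1 := by
  have hm2 : (2 : ℝ) ≤ m := by exact_mod_cast hm
  have hp : 0 < (m : ℝ) - 1 + τ := by linarith
  have := one_sub_mul_edgeRatio hp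
  have h2 : 0 < m * τ / ((m : ℝ) - 1 + τ) := by positivity
  linarith

/-- The bound on the information with the parameter `β` expressed through `τ`. -/
lemma mutualInfo_le_infoBound_edgeRatio {κ : Type*} [Fintype κ]
    (e : OrthonormalBasis (Fin m) ℂ H) (hm : 2 ≤ m)
    (h0 : 0 ≤ r0) (h1 : 0 ≤ r1) (hs : r0 + (m - 1) * r1 = 1) {M : κ → H →L[ℂ] H}
    (hM : IsObservable M) (hτ0 : 0 ≤ τ) (hτ1 : τ ≤ 1) (hg : gObt m τ ≤ 0)
    (hflat : τ = 0 → r0 = 0) :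
    mutualInfo (pyramidEnsemble e r0 r1 hm h0 h1 hs) M ≤ infoBound m r0 (edgeRatio m τ) := by
  have hm2 : (2 : ℝ) ≤ m := by exact_mod_cast hm
  have hp : 0 < (m : ℝ) - 1 + τ := by linarith
  refine mutualInfo_le_infoBound e hm h0 h1 hs hM (edgeRatio_nonneg hp hτ1)
    (mul_edgeRatio_le_one hm hτ0) ?_ fun h => hflat ?_
  · rw [constCoef_edgeRatio hm hp hτ1]
    nlinarith [Real.log_pos one_lt_two]
  · by_contra hne
    exact (mul_edgeRatio_lt_one hm (lt_of_le_of_ne hτ0 (Ne.symm hne))).ne h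

lemma isInfoOptimal_pyramidObservable_one (e : OrthonormalBasis (Fin m) ℂ H) (hm : 2 ≤ m)
    (h0 : 0 ≤ r0) (h1 : 0 < r1) (hs : r0 + (m - 1) * r1 = 1) (hτ0 : 0 ≤ τ) (hτ1 : τ ≤ 1)
    (hτ : √r0 = τ * √r1) (hg : gObt m τ ≤ 0) :
    IsInfoOptimal (pyramidEnsemble e r0 r1 hm h0 h1.le hs) (pyramidObservable e 1) := by
  refine ⟨isObservable_pyramidObservable e hm le_rfl, fun n N hN => ?_⟩
  rw [mutualInfo_pyramidObservable_one e hm h0 h1 hs hτ0 hτ1 hτ]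
  refine mutualInfo_le_infoBound_edgeRatio e hm h0 h1.le hs hN hτ0 hτ1 hg fun h => ?_
  rw [h, zero_mul, Real.sqrt_eq_zero h0] at hτ
  exact hτ

lemma infoBound_of_gObt_eq_zero (hm : 2 ≤ m) (hτ0 : 0 ≤ τ) (hτ1 : τ ≤ 1) (hg : gObt m τ = 0) :
    infoBound m r0 (edgeRatio m τ) =
      logb 2 (m / 2) + sumCoef (m - 1) (edgeRatio m τ) * (m * r0) / log 2 := by
  have hm2 : (2 : ℝ) ≤ m := by exact_mod_cast hm
  have hl2 := (Real.log_pos one_lt_two).ne'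
  unfold infoBound
  rw [constCoef_edgeRatio hm (by linarith) hτ1, hg, Real.logb_div (by linarith) two_ne_zero,
    Real.logb_self_eq_one one_lt_two]
  field_simp
  ring

lemma mutualInfo_le_logb (e : OrthonormalBasis (Fin m) ℂ H) (hm : 2 ≤ m)
    (h0 : 0 ≤ r0) (h1 : 0 ≤ r1) (hs : r0 + (m - 1) * r1 = 1) {n : ℕ} {M : Fin n → H →L[ℂ] H}
    (hM : IsObservable M) :
    mutualInfo (pyramidEnsemble e r0 r1 hm h0 h1 hs) M ≤ logb 2 m := by
  have := mutualInfo_le_of_majorant e hm h0 h1 hs hM (c := 0) (μ := 0) fun v => by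
    have := negEntropy_nonpos (u := fun j => ‖inner ℂ (edge e r0 r1 j) v‖ ^ 2) fun _ => sq_nonneg _
    simpa using this
  simpa using this

end

end QPyramid

end

theorem corollary2 {H : Type*} [NormedAddCommGroup H] [InnerProductSpace ℂ H]
    [FiniteDimensional ℂ H] (m : ℕ) (hm : 2 ≤ m) (e : OrthonormalBasis (Fin m) ℂ H)
    (r0 r1 : ℝ) (hr0 : 0 ≤ r0) (hr : r0 ≤ r1) (hsum : r0 + (m - 1) * r1 = 1) :
    let E := QPyramid.pyramidEnsemble e r0 r1 hm hr0 (hr0.trans hr) hsum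
    let p := QPyramid.coefA m r0 r1 ^ 2
    -- the constants `τ_o(m)` and `p(m)` are well defined
    (IsGreatest {τ : ℝ | τ ≤ 1 ∧ QPyramid.gObt m τ = 0} (QPyramid.tauObt m) ∧
      (m ≤ 6 → {τ : ℝ | τ ∈ Set.Icc 0 1 ∧ QPyramid.gObt m τ = 0} = {QPyramid.tauObt m}) ∧
      (7 ≤ m → QPyramid.tauObt m < 0 ∧ QPyramid.pObt m < ((m : ℝ) - 1) / m) ∧
      p ∈ Set.Icc (((m : ℝ) - 1) / m) 1) ∧
    -- the information-optimal observable
    ((7 ≤ m → QPyramid.IsInfoOptimal E (QPyramid.pyramidObservable e 1)) ∧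
      (m ≤ 6 → QPyramid.pObt m ≤ p →
        QPyramid.IsInfoOptimal E (QPyramid.pyramidObservable e 1)) ∧
      (m ≤ 6 → 0 < r0 → p ≤ QPyramid.pObt m →
        1 ≤ √(r1 / r0) * QPyramid.tauObt m ∧
        QPyramid.IsInfoOptimal E
          (QPyramid.pyramidObservable e (√(r1 / r0) * QPyramid.tauObt m)))) ∧
    -- the accessible information
    (BddAbove (QPyramid.infoValues E) ∧
      (p ∈ Set.Icc (max (((m : ℝ) - 1) / m) (QPyramid.pObt m)) 1 →
        QPyramid.accessibleInfo E = QPyramid.srmInfo m r0 r1) ∧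
      (m ≤ 6 → p ∈ Set.Icc (((m : ℝ) - 1) / m) (QPyramid.pObt m) →
        QPyramid.accessibleInfo E = Real.logb 2 (m / 2) -
            r0 * ((QPyramid.tauObt m)⁻¹ - 1) *
              Real.logb 2 (2 * (QPyramid.tauObt m - 1) ^ 2 /
                (m * (m - 1 + QPyramid.tauObt m ^ 2))) ∧
        QPyramid.accessibleInfo E = Real.logb 2 (m / 2) -
            r0 * m * QPyramid.muTilde0 m (QPyramid.pObt m))) := by
  intro E p
  have hm2 : (2 : ℝ) ≤ m := by exact_mod_cast hm
  have hn : 0 < (m : ℝ) - 1 := by linarith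
  have hr1 : 0 < r1 := by
    by_contra h
    push Not at h
    nlinarith
  have hsr1 : 0 < √r1 := Real.sqrt_pos.2 hr1
  -- the parameter of the pyramid
  obtain ⟨τ, hτ⟩ : ∃ τ, τ = √r0 / √r1 := ⟨_, rfl⟩
  have hτ0 : 0 ≤ τ := by rw [hτ]; positivity
  have hτ1 : τ ≤ 1 := by
    rw [hτ, div_le_one hsr1]
    exact Real.sqrt_le_sqrt hr
  have hτr : √r0 = τ * √r1 := by rw [hτ]; field_simp
  have hp : 0 < (m : ℝ) - 1 + τ := by linarith
  have hpA : p = (1 + (m - 1) * QPyramid.edgeRatio m τ ^ 2)⁻¹ :=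
    QPyramid.coefA_sq hr1 hm hr0 hτ0 hτr hsum
  have hβ0 := QPyramid.edgeRatio_nonneg hp hτ1
  have hβ1 := QPyramid.mul_edgeRatio_le_one hm hτ0
  -- the critical parameter
  have hgr := QPyramid.isGreatest_tauObt hm
  have hτo1 := QPyramid.tauObt_lt_one hm
  have hpo := QPyramid.tauObt_gt hm
  have hpObt := QPyramid.pObt_eq hm
  have hβo := QPyramid.edgeRatio_pos hpo hτo1
  -- Both p as a function of β and β as a function of τ are decreasing.
  have hple : QPyramid.pObt m ≤ p ↔ QPyramid.tauObt m ≤ τ := by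
    rw [hpA, hpObt, QPyramid.inv_one_add_le_iff hn hβo.le hβ0, QPyramid.edgeRatio_le_iff hm hp hpo]
  have hpge : p ≤ QPyramid.pObt m ↔ τ ≤ QPyramid.tauObt m := by
    rw [hpA, hpObt, QPyramid.inv_one_add_le_iff hn hβ0 hβo.le, QPyramid.edgeRatio_le_iff hm hpo hp]
  have hg7 : 7 ≤ m → QPyramid.gObt m τ ≤ 0 := fun h =>
    ((QPyramid.gObt_strictAntiOn hm).antitoneOn ⟨le_rfl, zero_le_one⟩ ⟨hτ0, hτ1⟩ hτ0).trans
      (QPyramid.gObt_zero_neg h).le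
  have hg6 : m ≤ 6 → QPyramid.pObt m ≤ p → QPyramid.gObt m τ ≤ 0 := fun h6 hle => by
    have h1 := (QPyramid.gObt_strictAntiOn hm).antitoneOn
      ⟨QPyramid.tauObt_nonneg hm h6, hτo1.le⟩ ⟨hτ0, hτ1⟩ (hple.1 hle)
    rwa [hgr.1.2] at h1
  have hopt : QPyramid.gObt m τ ≤ 0 →
      QPyramid.IsInfoOptimal E (QPyramid.pyramidObservable e 1) :=
    QPyramid.isInfoOptimal_pyramidObservable_one e hm hr0 hr1 hsum hτ0 hτ1 hτr
  -- observables for nearly flat pyramids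
  have hnear : 0 < r0 → p ≤ QPyramid.pObt m →
      0 < QPyramid.tauObt m ∧ 1 ≤ √(r1 / r0) * QPyramid.tauObt m ∧
      (√(r1 / r0) * QPyramid.tauObt m) * √r0 = QPyramid.tauObt m * √r1 := by
    intro hr0' hle
    have hsr0 : 0 < √r0 := Real.sqrt_pos.2 hr0'
    have hle' := hpge.1 hle
    rw [hτ, div_le_iff₀ hsr1] at hle'
    have hτo : 0 < QPyramid.tauObt m := pos_of_mul_pos_left (hsr0.trans_le hle') hsr1.le
    refine ⟨hτo, ?_, ?_⟩
    · rw [Real.sqrt_div hr1.le, div_mul_eq_mul_div, le_div_iff₀ hsr0]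
      linarith
    · rw [Real.sqrt_div hr1.le]
      field_simp
  have hoptNear : m ≤ 6 → 0 < r0 → p ≤ QPyramid.pObt m →
      QPyramid.IsInfoOptimal E
          (QPyramid.pyramidObservable e (√(r1 / r0) * QPyramid.tauObt m)) ∧
      QPyramid.mutualInfo E (QPyramid.pyramidObservable e (√(r1 / r0) * QPyramid.tauObt m)) =
        QPyramid.infoBound m r0 (QPyramid.edgeRatio m (QPyramid.tauObt m)) := by
    intro h6 hr0' hle
    obtain ⟨hτo, ht1, ht⟩ := hnear hr0' hle
    have hval : QPyramid.mutualInfo E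
        (QPyramid.pyramidObservable e (√(r1 / r0) * QPyramid.tauObt m)) =
        QPyramid.infoBound m r0 (QPyramid.edgeRatio m (QPyramid.tauObt m)) := by
      refine QPyramid.mutualInfo_pyramidObservable e hm hr0 hr1 hsum hτo.le hτo1.le ht1 ht ?_
      refine (QPyramid.constCoef_edgeRatio hm hpo hτo1.le).trans ?_
      rw [hgr.1.2]; ring
    refine ⟨⟨QPyramid.isObservable_pyramidObservable e hm ht1, fun n N hN => ?_⟩, hval⟩
    rw [hval]
    exact QPyramid.mutualInfo_le_infoBound_edgeRatio e hm hr0 (hr0.trans hr) hsum hN hτo.le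
      hτo1.le hgr.1.2.le fun h => absurd h hτo.ne'
  refine ⟨⟨hgr, QPyramid.setOf_zero_eq_singleton hm,
    fun h => ⟨QPyramid.tauObt_neg h, QPyramid.pObt_lt h⟩, ?_, ?_⟩,
    ⟨fun h => hopt (hg7 h), fun h6 hle => hopt (hg6 h6 hle),
      fun h6 hr0' hle => ⟨(hnear hr0' hle).2.1, (hoptNear h6 hr0' hle).1⟩⟩, ?_, ?_, ?_⟩
  · rw [hpA, div_le_iff₀ (by linarith), ← div_eq_inv_mul, le_div_iff₀ (by positivity)]
    have h1 : (((m : ℝ) - 1) * QPyramid.edgeRatio m τ) ^ 2 ≤ 1 :=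
      pow_le_one₀ (by positivity) hβ1
    nlinarith
  · rw [hpA]
    exact inv_le_one_of_one_le₀ (by nlinarith [sq_nonneg (QPyramid.edgeRatio m τ)])
  · refine ⟨Real.logb 2 m, ?_⟩
    rintro _ ⟨n, N, hN, rfl⟩
    exact QPyramid.mutualInfo_le_logb e hm hr0 (hr0.trans hr) hsum hN
  · intro hmem
    have hg : QPyramid.gObt m τ ≤ 0 := by
      rcases Nat.lt_or_ge 6 m with h | h
      · exact hg7 h
      · exact hg6 h ((le_max_right _ _).trans hmem.1)
    rw [QPyramid.accessibleInfo_eq (hopt hg), ← QPyramid.infoBound_eq_srmInfo hr1 hm hr0 hτ0 hτ1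
      hτr hsum]
    exact QPyramid.mutualInfo_pyramidObservable_one e hm hr0 hr1 hsum hτ0 hτ1 hτr
  · intro h6 hmem
    rcases hr0.eq_or_lt with h | h
    -- For r0 = 0 the parameter t would be infinite, so `flatObservable` attains the bound instead.
    · subst h
      have hτo0 := QPyramid.tauObt_nonneg hm h6
      have hval := QPyramid.mutualInfo_flatObservable e hm hr1 hsum
      have hlog : Real.logb 2 m + (-Real.log 2 + 0 * (m * 0)) / Real.log 2 =
          Real.logb 2 (m / 2) := by
        rw [Real.logb_div (by linarith) two_ne_zero, Real.logb_self_eq_one one_lt_two]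
        field_simp
        ring
      have hflat : QPyramid.IsInfoOptimal E (QPyramid.flatObservable e) := by
        refine ⟨QPyramid.isObservable_flatObservable e hm, fun n N hN => ?_⟩
        refine (QPyramid.mutualInfo_le_infoBound_edgeRatio e hm hr0 (hr0.trans hr) hsum hN hτo0
          hτo1.le hgr.1.2.le fun _ => rfl).trans ?_
        rw [QPyramid.infoBound_of_gObt_eq_zero hm hτo0 hτo1.le hgr.1.2, hval, hlog]
        simp
      have hacc : QPyramid.accessibleInfo E = Real.logb 2 (m / 2) := by
        rw [QPyramid.accessibleInfo_eq hflat, hval, hlog]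
      rw [hacc]
      -- The factor r0 = 0 removes both corrections, also for m = 2, where τ_o = 0 and its inverse
      -- is 0 by convention.
      simp
    · obtain ⟨hτo, -, -⟩ := hnear h hmem.2
      obtain ⟨hio, hval⟩ := hoptNear h6 h hmem.2
      have hacc : QPyramid.accessibleInfo E = Real.logb 2 (m / 2) + QPyramid.sumCoef (m - 1)
          (QPyramid.edgeRatio m (QPyramid.tauObt m)) * (m * r0) / Real.log 2 := by
        rw [QPyramid.accessibleInfo_eq hio, hval,
          QPyramid.infoBound_of_gObt_eq_zero hm hτo.le hτo1.le hgr.1.2]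
      refine ⟨?_, ?_⟩
      · rw [hacc, QPyramid.logb_of_gObt_eq_zero hm hτo1 hgr.1.2,
          QPyramid.sumCoef_edgeRatio hm hτo hτo1]
        have hm0 : (m : ℝ) ≠ 0 := by linarith
        field_simp
        ring
      · rw [hacc, hpObt, QPyramid.muTilde0_eq hm hβo (QPyramid.mul_edgeRatio_lt_one hm hτo)]
        ring
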